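/- Let $d,m\ge 1$ and $\mathbb E=\mathbb R^d\times\{1,\dots,m\}$; a point $(x,i)$ is the point $x$ with colour $i$. Let $C_R=(-R/2,R/2)^d$ and let $\ell$ be Lebesgue measure. A set $\Lambda\subset\mathbb E$ is $r$-uniformly discrete if for every $a\in\mathbb R^d$ at most one $(x,i)\in\Lambda$ has $x\in a+C_r$. For a measure $\lambda$ on $\mathbb E$ let $\lambda^i$ be its part of colour $i$, viewed as a measure on $\mathbb R^d$, and let $T_t\lambda$ be its translate by $t\in\mathbb R^d$. Let $\mu$ be the law of a uniformly discrete, multicoloured, stationary, ergodic point process on $\mathbb R^d$, that is, a probability measure on the measures on $\mathbb E$ (with the $\sigma$-algebra generated by the maps $\lambda\mapsto\lambda(A)$, $A\subset\mathbb E$ Borel) such that: for some $r>0$, $\mu$-almost every $\lambda$ has the form $\sum_{p\in\Lambda}\delta_p$ with $\Lambda$ an $r$-uniformly discrete set; $\mu$ is invariant under all $T_t$; every measurable set that is invariant under all $T_t$ has $\mu$-measure $0$ or $1$; and for each $i$ the intensity $I^{(i)}=\int\lambda^i(C_1)\,d\mu(\lambda)$ is positive. Let $w=(w_1,\dots,w_m)\in\mathbb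 R^m$ be a system of weights, and put $\lambda^w=\sum_i w_i\lambda^i$ and $N^w_f(\lambda)=\lambda^w(f)=\sum_i w_i\int f\,d\lambda^i$. Let $\dot\mu^w$ be the weighted Palm measure, $$\dot\mu^w(D)=\int\sum_{x\in C_1}\lambda^w(\{x\})\,\mathbf 1_D(T_{-x}\lambda)\,d\mu(\lambda),$$ and let $\dot\mu^w_1$, defined by $\dot\mu^w_1(f)=\int N^w_f\,d\dot\mu^w$, be its weighted first moment. With $\hat f(y)=\int e^{-2\pi i\,y\cdot x}f(x)\,dx$ and $\mathbb S$ the space of rapidly decreasing (Schwartz) functions on $\mathbb R^d$, the following hold. There is exactly one positive Radon measure $\nu=\widehat{\dot\mu^w_1}$ on $\mathbb R^d$ for which every $f\in\mathbb S$ is integrable and $\int f\,d\nu=\dot\mu^w_1(\hat f)$ for all $f\in\mathbb S$. There is exactly one linear isometry $\theta^w:L^2(\mathbb R^d,\nu)\to L^2(\mu)$ with $\theta^w(\hat f)=N^w_f$ for all $f\in\mathbb S$. Let $U$ be the representation of $\mathbb R^d$ on $L^2(\mathbb R^d,\nu)$ given by $U_tf(x)=e^{-2\pi i\,t\cdot x}f(x)$;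 $k\in\mathbb R^d$ is an eigenvalue of $U$ if there is a nonzero $f\in L^2(\mathbb R^d,\nu)$ with $U_tf=e^{2\pi i\,k\cdot t}f$ for all $t\in\mathbb R^d$. **Theorem 9.1 (square-mean Bombieri–Taylor).** For every $k\in\mathbb R^d$ the averages $$A_R(\lambda)=\frac1{\ell(C_R)}\sum_{x\in C_R}\lambda^w(\{x\})\,e^{2\pi i\,k\cdot x}\qquad(R>0)$$ belong to $L^2(\mu)$, and the following are equivalent: (i) $A_R\nrightarrow 0$ in $L^2(\mu)$ as $R\to\infty$; (ii) $\widehat{\dot\mu^w_1}(\{k\})\ne 0$; (iii) $k$ is an eigenvalue of $U$. If $k$ is an eigenvalue of $U$, then $A_R\to\theta^w(\mathbf 1_{\{k\}})$ in $L^2(\mu)$ as $R\to\infty$. -/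

import Mathlib

open MeasureTheory Filter Topology
open scoped FourierTransform SchwartzMap ENNReal

namespace ColouredPointProcess

/-- Euclidean space `ℝ^d`. -/
abbrev Space (d : ℕ) : Type := EuclideanSpace ℝ (Fin d)

/-- `𝔼 = ℝ^d × {1, …, m}`: a pair `(x, i)` is the point `x` with colour `i`. -/
abbrev ColouredSpace (d m : ℕ) : Type := Space d × Fin m

/-- The open cube `C_R` of edge length `R` centred at `0`. -/
def cube (d : ℕ) (R : ℝ) : Set (Space d) := {x | ∀ j, |x j| < R / 2}

/-- `Λ ⊆ 𝔼` is `r`-uniformly discrete: every translate `a + C_r` contains the position of at most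
one point of `Λ`, all colours taken together. -/
def UniformlyDiscrete {d m : ℕ} (r : ℝ) (Λ : Set (ColouredSpace d m)) : Prop :=
  ∀ a : Space d, {p ∈ Λ | p.1 - a ∈ cube d r}.encard ≤ 1

/-- The point measures `∑_{p ∈ Λ} δ_p` on `𝔼` whose support `Λ` is `r`-uniformly discrete. -/
def pointMeasures (d m : ℕ) (r : ℝ) : Set (Measure (ColouredSpace d m)) :=
  {η | ∃ Λ : Set (ColouredSpace d m), UniformlyDiscrete r Λ ∧
    η = Measure.sum fun p : Λ => Measure.dirac (p : ColouredSpace d m)}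

/-- The translate `T_t η` of a measure on `𝔼`: `(T_t η)(A) = η (-t + A)`. -/
noncomputable def translate {d m : ℕ} (t : Space d) (η : Measure (ColouredSpace d m)) :
    Measure (ColouredSpace d m) :=
  η.map fun p => (t + p.1, p.2)

/-- The part `η^i` of colour `i` of a measure on `𝔼`, as a measure on `ℝ^d`. -/
noncomputable def colour {d m : ℕ} (η : Measure (ColouredSpace d m)) (i : Fin m) :
    Measure (Space d) :=
  (η.restrict {p | p.2 = i}).map Prod.fst

/-- The intensity of colour `i`: the expected number of points of colour `i` per unit volume. For a
stationary process `∫ η^i(A) dμ(η)` is a multiple of the volume of `A`, and the cube `C_1` has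
volume `1`. -/
noncomputable def intensity {d m : ℕ} (μ : Measure (Measure (ColouredSpace d m))) (i : Fin m) :
    ℝ≥0∞ :=
  ∫⁻ η, colour η i (cube d 1) ∂μ

/-- `μ` is the law of a uniformly discrete `m`-coloured point process on `ℝ^d` that is stationary,
ergodic, and has positive intensity in every colour. The space of measures on `𝔼` carries the
`σ`-algebra generated by the evaluations `η ↦ η A`. -/
structure IsUniformlyDiscreteStationaryErgodic {d m : ℕ}
    (μ : Measure (Measure (ColouredSpace d m))) : Prop where
  isProbabilityMeasure : IsProbabilityMeasure μ
  uniformlyDiscrete : ∃ r : ℝ, 0 < r ∧ ∀ᵐ η ∂μ, η ∈ pointMeasures d m r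
  stationary : ∀ t : Space d, μ.map (translate t) = μ
  ergodic : ∀ D : Set (Measure (ColouredSpace d m)), MeasurableSet D →
    (∀ t : Space d, translate t ⁻¹' D = D) → μ D = 0 ∨ μ D = 1
  intensity_pos : ∀ i : Fin m, 0 < intensity μ i

/-- `η^w({x})`, where `η^w = ∑ i, w_i η^i` is the weighted version of `η`. -/
noncomputable def weightedMass {d m : ℕ} (w : Fin m → ℝ) (η : Measure (ColouredSpace d m))
    (x : Space d) : ℝ :=
  ∑ i, w i * (colour η i).real {x}

/-- The weighted counting function `N^w_f(η) = η^w(f) = ∑ i, w_i ∫ f dη^i`. -/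
noncomputable def weightedCount {d m : ℕ} (w : Fin m → ℝ) (f : Space d → ℂ)
    (η : Measure (ColouredSpace d m)) : ℂ :=
  ∑ i, (w i : ℂ) * ∫ x, f x ∂(colour η i)

/-- The Palm measure of the points of colour `i`:
`D ↦ ∫ ∑_{x ∈ C_1} η^i({x}) 1_D(T_{-x} η) dμ(η)`, where the cube `C_1` has volume `1`. -/
noncomputable def palm {d m : ℕ} (μ : Measure (Measure (ColouredSpace d m))) (i : Fin m) :
    Measure (Measure (ColouredSpace d m)) :=
  μ.bind fun η => ((colour η i).restrict (cube d 1)).map fun x => translate (-x) η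

/-- The integral of `F` against the weighted Palm measure `∑ i, w_i (palm μ i)`, which is a signed
measure. -/
noncomputable def weightedPalmIntegral {d m : ℕ} (μ : Measure (Measure (ColouredSpace d m)))
    (w : Fin m → ℝ) (F : Measure (ColouredSpace d m) → ℂ) : ℂ :=
  ∑ i, (w i : ℂ) * ∫ η, F η ∂(palm μ i)

/-- The weighted first moment of the weighted Palm measure, as a functional on functions on `ℝ^d`:
`f` is sent to the integral of `N^w_f` against the weighted Palm measure. -/
noncomputable def weightedFirstMoment {d m : ℕ} (μ : Measure (Measure (ColouredSpace d m)))
    (w : Fin m → ℝ) (f : Space d → ℂ) : ℂ :=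
  weightedPalmIntegral μ w (weightedCount w f)

/-- The positive Radon measure `ν` is the Fourier transform of the (signed) measure `ω`, given as a
functional: `ν(f) = ω(f̂)` for all rapidly decreasing `f`, with
`f̂(y) = ∫ exp(-2πi y·x) f(x) dx`. -/
structure IsFourierTransform {d : ℕ} (ω : (Space d → ℂ) → ℂ) (ν : Measure (Space d)) : Prop where
  isLocallyFinite : IsLocallyFiniteMeasure ν
  integrable : ∀ f : 𝓢(Space d, ℂ), Integrable (fun x => f x) ν
  integral_eq : ∀ f : 𝓢(Space d, ℂ), ∫ x, f x ∂ν = ω (fun y => (𝓕 f : 𝓢(Space d, ℂ)) y)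

/-- The isometric linear map `θ : L²(ℝ^d, ν) → L²(μ)` extends the assignment `f̂ ↦ N^w_f`,
`f` rapidly decreasing. -/
def IsDiffractionEmbedding {d m : ℕ} (μ : Measure (Measure (ColouredSpace d m))) (w : Fin m → ℝ)
    (ν : Measure (Space d)) (θ : Lp ℂ 2 ν →ₗᵢ[ℂ] Lp ℂ 2 μ) : Prop :=
  ∀ f : 𝓢(Space d, ℂ), ∃ hf : MemLp (fun y => (𝓕 f : 𝓢(Space d, ℂ)) y) 2 ν,
    θ (hf.toLp _) =ᵐ[μ] weightedCount w f

/-- The character `χ_k(x) = exp(2πi k·x)`. -/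
noncomputable def character {d : ℕ} (k x : Space d) : ℂ :=
  Complex.exp (2 * Real.pi * Complex.I * (inner ℝ k x : ℝ))

theorem norm_character {d : ℕ} (k x : Space d) : ‖character k x‖ = 1 := by
  have h : (2 * Real.pi * Complex.I * (inner ℝ k x : ℝ) : ℂ)
      = ((2 * Real.pi * inner ℝ k x : ℝ) : ℂ) * Complex.I := by
    push_cast; ring
  rw [character, h, Complex.norm_exp_ofReal_mul_I]

theorem continuous_character {d : ℕ} (k : Space d) : Continuous (character k) := by
  unfold character
  fun_prop

theorem memLp_character_mul {d : ℕ} {ν : Measure (Space d)} (k : Space d) {f : Space d → ℂ}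
    (hf : MemLp f 2 ν) : MemLp (fun x => character k x * f x) 2 ν :=
  hf.of_le ((continuous_character k).aestronglyMeasurable.mul hf.1)
    (Eventually.of_forall fun x => by rw [norm_mul, norm_character, one_mul])

/-- The representation `U` of `ℝ^d` on `L²(ℝ^d, ν)`:
`(U_t f)(x) = exp(-2πi t·x) f(x) = χ_{-t}(x) f(x)`. -/
noncomputable def U {d : ℕ} (ν : Measure (Space d)) (t : Space d) :
    Lp ℂ 2 ν →ₗ[ℂ] Lp ℂ 2 ν where
  toFun f := (memLp_character_mul (-t) (Lp.memLp f)).toLp _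
  map_add' f g := by
    rw [← MemLp.toLp_add]
    apply MemLp.toLp_congr
    filter_upwards [Lp.coeFn_add f g] with x hx
    simp only [hx, Pi.add_apply, mul_add]
  map_smul' c f := by
    rw [RingHom.id_apply, ← MemLp.toLp_const_smul]
    apply MemLp.toLp_congr
    filter_upwards [Lp.coeFn_smul c f] with x hx
    simp only [hx, Pi.smul_apply, smul_eq_mul]
    ring

/-- `k` is an eigenvalue of `U`: some nonzero `f ∈ L²(ℝ^d, ν)` satisfies `U_t f = χ_k(t) f` for all
`t`. -/
def IsEigenvalue {d : ℕ} (ν : Measure (Space d)) (k : Space d) : Prop :=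
  ∃ f : Lp ℂ 2 ν, f ≠ 0 ∧ ∀ t : Space d, U ν t f = character k t • f

/-- The average `(1 / ℓ(C_R)) ∑_{x ∈ C_R} η^w({x}) exp(2πi k·x)`. -/
noncomputable def average {d m : ℕ} (w : Fin m → ℝ) (k : Space d) (R : ℝ)
    (η : Measure (ColouredSpace d m)) : ℂ :=
  ((volume.real (cube d R) : ℝ) : ℂ)⁻¹ *
    ∑' x : cube d R, (weightedMass w η x : ℂ) * character k x

/-- The indicator function of `{k}` belongs to `L²` of a Radon measure. -/
theorem memLp_indicator_singleton {d : ℕ} {ω : (Space d → ℂ) → ℂ} {ν : Measure (Space d)}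
    (hν : IsFourierTransform ω ν) (k : Space d) :
    MemLp (Set.indicator {k} fun _ : Space d => (1 : ℂ)) 2 ν := by
  have := hν.isLocallyFinite
  exact memLp_indicator_const 2 (measurableSet_singleton k) 1
    (Or.inr (isCompact_singleton.measure_lt_top (μ := ν)).ne)

end ColouredPointProcess

namespace ColouredPointProcess

open ProbabilityTheory

/-! Write `ω` for the weighted first moment of the Palm measure. Stationarity enters through the
refined Campbell formula (`lintegral_campbell`), which turns second moments of the process into
first moments of the Palm measure: the integral of `N^w_f` times the conjugate of `N^w_g` is `ω` of
the correlation `z ↦ ∫ f(x) conj(g(x + z)) dx`. By Parseval this correlation is the Fourier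
transform of `f̂ · conj ĝ`. Hence `h ↦ ω(ĥ)` is nonnegative on squares `|φ|²`
(`isNonnegOnSquares_moment`), and a smooth version of Riesz–Markov
(`IsNonnegOnSquares.exists_measure`) represents it on compactly supported functions by a positive
measure `ν`. Since `ω` is bounded by the decay of its argument, which modulation does not affect,
`ν` has uniformly bounded mass on unit balls (`exists_translationBounded`); so Schwartz functions
are integrable and the identity extends to them by density. The same second moment identity says
that `N^w_f` and `f̂` have equal norms, so `f̂ ↦ N^w_f` extends uniquely to the isometry `θ`.

The average `A_R` is the weighted count of `R^{-d} 1_{C_R} χ_k`. To obtain a Schwartz function,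
`1_{C_1}` is replaced by a smooth `φ` that is `1` on `C_{1-ε}` and `0` off `C_1`. The scaled
function then has Fourier transform `φ̂(R(y - k))`, which tends to `φ̂(0) 1_{k}` in `L²(ν)`, and `θ`
carries this to `L²(μ)`. The error of the replacement is deterministic: it counts points in a thin
shell along the boundary of `C_R`, and uniform discreteness bounds their number by a small multiple
of `R^d`. Thus `A_R → θ(1_{k})` for every `k` (`tendsto_average`).

As `θ` is isometric, this limit vanishes exactly when `ν {k} = 0`. An eigenfunction of `U` for `k`
is concentrated at `-k` (`isEigenvalue_iff`), and real weights make `ν` symmetric under reflection,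
which removes the sign. -/

/-- A measure on `ℝ^d` gives mass at most `K` to every ball of radius `ρ`. -/
def TranslationBounded {d : ℕ} (ρ : ℝ) (K : ℝ≥0∞) (ν : Measure (Space d)) : Prop :=
  ∀ a, ν (Metric.ball a ρ) ≤ K

/-! ### Translation bounded measures and a universal integrable weight. -/

section TranslationBounded

variable {d : ℕ} {ρ : ℝ} {K : ℝ≥0∞} {ν : Measure (Space d)}

theorem TranslationBounded.isLocallyFiniteMeasure (h : TranslationBounded ρ K ν) (hρ : 0 < ρ)
    (hK : K ≠ ∞) : IsLocallyFiniteMeasure ν :=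
  ⟨fun x => ⟨Metric.ball x ρ, Metric.ball_mem_nhds x hρ, (h x).trans_lt hK.lt_top⟩⟩

/-- The integral against a translation bounded measure is controlled by the Lebesgue integral of a
local majorant. -/
theorem TranslationBounded.lintegral_le (h : TranslationBounded ρ K ν) (hρ : 0 < ρ) (hK : K ≠ ∞)
    {f g : Space d → ℝ≥0∞} (hf : Measurable f)
    (hfg : ∀ x a, dist x a < ρ → f x ≤ g a) :
    ∫⁻ x, f x ∂ν ≤ K * (volume (Metric.ball (0 : Space d) ρ))⁻¹ * ∫⁻ a, g a := by
  classical
  have := h.isLocallyFiniteMeasure hρ hK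
  set V := volume (Metric.ball (0 : Space d) ρ) with hV
  have hV0 : V ≠ 0 := (Metric.measure_ball_pos volume _ hρ).ne'
  have hVt : V ≠ ∞ := measure_ball_lt_top.ne
  have hm : MeasurableSet {p : Space d × Space d | dist p.1 p.2 < ρ} :=
    (isOpen_lt continuous_dist continuous_const).measurableSet
  -- Double counting over the pairs with `dist x a < ρ`: each `x` sees volume `V`, and each `a` sees
  -- `ν`-mass at most `K`, on which `f` is at most `g a`.
  have key : V * ∫⁻ x, f x ∂ν ≤ K * ∫⁻ a, g a := by
    calc V * ∫⁻ x, f x ∂ν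
        = ∫⁻ x, ∫⁻ a, {p : Space d × Space d | dist p.1 p.2 < ρ}.indicator (fun p => f p.1) (x, a)
            ∂volume ∂ν := by
          rw [← lintegral_const_mul _ hf]
          refine lintegral_congr fun x => ?_
          have : ∀ a, {p : Space d × Space d | dist p.1 p.2 < ρ}.indicator (fun p => f p.1) (x, a)
              = (Metric.ball x ρ).indicator (fun _ => f x) a := by
            intro a
            simp only [Set.indicator_apply, Set.mem_ofPred_eq, Metric.mem_ball, dist_comm x a]
          simp_rw [this]
          rw [lintegral_indicator_const Metric.isOpen_ball.measurableSet, mul_comm,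
            Measure.addHaar_ball_center]
      _ = ∫⁻ a, ∫⁻ x, {p : Space d × Space d | dist p.1 p.2 < ρ}.indicator (fun p => f p.1) (x, a)
            ∂ν ∂volume :=
          lintegral_lintegral_swap ((hf.comp measurable_fst).indicator hm).aemeasurable
      _ ≤ ∫⁻ a, K * g a := by
          refine lintegral_mono fun a => ?_
          calc _ ≤ ∫⁻ x, (Metric.ball a ρ).indicator (fun _ => g a) x ∂ν := by
                refine lintegral_mono fun x => ?_
                simp only [Set.indicator_apply, Set.mem_ofPred_eq, Metric.mem_ball]
                split_ifs with hx
                · exact hfg x a hx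
                · exact le_rfl
            _ = g a * ν (Metric.ball a ρ) :=
                lintegral_indicator_const Metric.isOpen_ball.measurableSet _
            _ ≤ K * g a := by rw [mul_comm]; gcongr; exact h a
      _ = K * ∫⁻ a, g a := lintegral_const_mul' _ _ hK
  calc ∫⁻ x, f x ∂ν = V⁻¹ * (V * ∫⁻ x, f x ∂ν) := by
        rw [← mul_assoc, ENNReal.inv_mul_cancel hV0 hVt, one_mul]
    _ ≤ V⁻¹ * (K * ∫⁻ a, g a) := by gcongr
    _ = _ := by ring

/-- A weight on `ℝ^d` that is integrable against every translation bounded measure. -/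
noncomputable def weight {d : ℕ} (x : Space d) : ℝ := (1 + ‖x‖) ^ (-(d + 1 : ℝ))

theorem weight_pos (x : Space d) : 0 < weight x := by unfold weight; positivity

theorem continuous_weight : Continuous (weight (d := d)) := by
  unfold weight
  refine Continuous.rpow_const (by fun_prop) fun x => Or.inl (by positivity)

theorem lintegral_weight_lt_top : ∫⁻ x : Space d, ENNReal.ofReal (weight x) < ∞ :=
  finite_integral_one_add_norm (by simp)

/-- Peetre-type inequality: `1 + ‖a‖ ≤ (1 + ρ) * (1 + ‖x‖)`, raised to the power `d + 1`. -/
theorem weight_le_of_dist_lt {x a : Space d} (h : dist x a < ρ) :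
    weight x ≤ (1 + ρ) ^ (d + 1 : ℝ) * weight a := by
  have hρ : 0 < ρ := dist_nonneg.trans_lt h
  unfold weight
  rw [Real.rpow_neg (by positivity), Real.rpow_neg (by positivity), ← div_eq_mul_inv,
    inv_le_comm₀ (by positivity) (by positivity), inv_div, div_le_iff₀ (by positivity),
    ← Real.mul_rpow (by positivity) (by positivity)]
  refine Real.rpow_le_rpow (by positivity) ?_ (by positivity)
  have h1 : ‖a‖ ≤ ‖x‖ + ρ := by
    have := norm_sub_norm_le a x
    rw [dist_eq_norm, norm_sub_rev] at h
    linarith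
  nlinarith [norm_nonneg x]

/-- A bound for the integral of `weight` against translation bounded measures. -/
noncomputable def weightBound (d : ℕ) (ρ : ℝ) (K : ℝ≥0∞) : ℝ≥0∞ :=
  K * (volume (Metric.ball (0 : Space d) ρ))⁻¹ *
    (ENNReal.ofReal ((1 + ρ) ^ (d + 1 : ℝ)) * ∫⁻ x : Space d, ENNReal.ofReal (weight x))

theorem weightBound_ne_top (hρ : 0 < ρ) (hK : K ≠ ∞) : weightBound d ρ K ≠ ∞ :=
  ENNReal.mul_ne_top (ENNReal.mul_ne_top hK
    (ENNReal.inv_ne_top.2 (Metric.measure_ball_pos volume _ hρ).ne'))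
    (ENNReal.mul_ne_top ENNReal.ofReal_ne_top lintegral_weight_lt_top.ne)

/-- Translation invariance of Lebesgue measure makes the bound independent of the centre `b`;
correlations need this uniformity. -/
theorem TranslationBounded.lintegral_weight_le (h : TranslationBounded ρ K ν) (hρ : 0 < ρ)
    (hK : K ≠ ∞) (b : Space d) :
    ∫⁻ x, ENNReal.ofReal (weight (x - b)) ∂ν ≤ weightBound d ρ K := by
  refine (h.lintegral_le hρ hK (g := fun a => ENNReal.ofReal ((1 + ρ) ^ (d + 1 : ℝ)) *
    ENNReal.ofReal (weight (a - b))) ?_ ?_).trans ?_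
  · exact (continuous_weight.measurable.comp (measurable_id.sub_const b)).ennreal_ofReal
  · intro x a hxa
    rw [← ENNReal.ofReal_mul (by positivity)]
    exact ENNReal.ofReal_le_ofReal (weight_le_of_dist_lt (by simpa using hxa))
  · rw [lintegral_const_mul' _ _ ENNReal.ofReal_ne_top,
      lintegral_sub_right_eq_self (fun x => ENNReal.ofReal (weight x)) b, weightBound]

theorem TranslationBounded.measure_ball_le (h : TranslationBounded ρ K ν) (hρ : 0 < ρ)
    (hK : K ≠ ∞) (R : ℝ) :
    ν (Metric.ball 0 R) ≤ K * (volume (Metric.ball (0 : Space d) ρ))⁻¹ *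
      volume (Metric.ball (0 : Space d) (R + ρ)) := by
  have := h.lintegral_le hρ hK (f := (Metric.ball 0 R).indicator 1)
    (g := (Metric.ball 0 (R + ρ)).indicator 1)
    (measurable_one.indicator Metric.isOpen_ball.measurableSet) ?_
  · rwa [lintegral_indicator_one Metric.isOpen_ball.measurableSet,
      lintegral_indicator_one Metric.isOpen_ball.measurableSet] at this
  · intro x a hxa
    by_cases hx : x ∈ Metric.ball 0 R
    · have ha : a ∈ Metric.ball 0 (R + ρ) := by
        rw [Metric.mem_ball] at hx ⊢
        have := dist_triangle_left a 0 x
        linarith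
      rw [Set.indicator_of_mem hx, Set.indicator_of_mem ha]; rfl
    · rw [Set.indicator_of_notMem hx]; exact zero_le

end TranslationBounded

/-! ### Sparse configurations as s-finite kernels. -/

section Sparse

variable {d m : ℕ} {ρ : ℝ}

/-- Every ball of radius `ρ` contains the position of at most one point of `η`. -/
def Sparse (ρ : ℝ) (η : Measure (ColouredSpace d m)) : Prop :=
  ∀ a, η (Prod.fst ⁻¹' Metric.ball a ρ) ≤ 1

/-- A measurable set of measures between those that are sparse with radius `ρ` and those that are
sparse with radius `ρ / 2`. -/
def sparseSet (d m : ℕ) (ρ : ℝ) : Set (Measure (ColouredSpace d m)) :=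
  {η | ∀ n, η (Prod.fst ⁻¹' Metric.ball (TopologicalSpace.denseSeq (Space d) n) ρ) ≤ 1}

theorem measurableSet_fst_ball (a : Space d) :
    MeasurableSet (Prod.fst ⁻¹' Metric.ball a ρ : Set (ColouredSpace d m)) :=
  measurable_fst Metric.isOpen_ball.measurableSet

theorem measurableSet_sparseSet : MeasurableSet (sparseSet d m ρ) := by
  have : sparseSet d m ρ = ⋂ n, {η | η (Prod.fst ⁻¹'
      Metric.ball (TopologicalSpace.denseSeq (Space d) n) ρ) ≤ 1} := by
    ext; simp [sparseSet]
  rw [this]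
  exact MeasurableSet.iInter fun n =>
    measurableSet_le (Measure.measurable_coe (measurableSet_fst_ball _)) measurable_const

theorem Sparse.mem_sparseSet {η : Measure (ColouredSpace d m)} (h : Sparse ρ η) :
    η ∈ sparseSet d m ρ := fun _ => h _

/-- A ball of radius `ρ / 2` lies in the `ρ`-ball about a nearby term of the dense sequence. The
halved radius is the price for testing only countably many centres, which makes `sparseSet`
measurable. -/
theorem sparse_of_mem_sparseSet (hρ : 0 < ρ) {η : Measure (ColouredSpace d m)}
    (h : η ∈ sparseSet d m ρ) : Sparse (ρ / 2) η := by
  intro a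
  obtain ⟨n, hn⟩ := (TopologicalSpace.denseRange_denseSeq (Space d)).exists_dist_lt a (half_pos hρ)
  refine (measure_mono ?_).trans (h n)
  intro p hp
  simp only [Set.mem_preimage, Metric.mem_ball] at hp ⊢
  have := dist_triangle p.1 a (TopologicalSpace.denseSeq (Space d) n)
  linarith

theorem sparse_zero : Sparse ρ (0 : Measure (ColouredSpace d m)) := fun _ => by simp

/-- A Euclidean ball of radius `r / 2` lies in the cube of edge `r` with the same centre, because
coordinates are bounded by the norm. -/
theorem Sparse.of_mem_pointMeasures {r : ℝ} {η : Measure (ColouredSpace d m)}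
    (h : η ∈ pointMeasures d m r) : Sparse (r / 2) η := by
  obtain ⟨Λ, hΛ, rfl⟩ := h
  intro a
  have hm : MeasurableSet (Prod.fst ⁻¹' Metric.ball a (r / 2) : Set (ColouredSpace d m)) :=
    measurableSet_fst_ball a
  rw [Measure.sum_apply _ hm]
  simp_rw [Measure.dirac_apply' _ hm]
  have hsub : ∀ p : ColouredSpace d m, p ∈ Λ → p ∈ (Prod.fst ⁻¹' Metric.ball a (r / 2) : Set _) →
      p ∈ {p ∈ Λ | p.1 - a ∈ cube d r} := fun p hp hpa => by
    refine ⟨hp, fun j => ?_⟩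
    rw [Set.mem_preimage, Metric.mem_ball, dist_eq_norm] at hpa
    exact (PiLp.norm_apply_le (p.1 - a) j).trans_lt hpa
  have huniq := Set.encard_le_one_iff.1 (hΛ a)
  by_cases hex : ∃ p : Λ, (p : ColouredSpace d m) ∈ (Prod.fst ⁻¹' Metric.ball a (r / 2) : Set _)
  · obtain ⟨p, hp⟩ := hex
    rw [tsum_eq_single p, Set.indicator_of_mem hp]
    · exact le_rfl
    · intro q hq
      refine Set.indicator_of_notMem (fun hqa => hq ?_) _
      exact Subtype.ext (huniq _ _ (hsub q q.2 hqa) (hsub p p.2 hp))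
  · push Not at hex
    rw [ENNReal.tsum_eq_zero.2 fun q => Set.indicator_of_notMem (hex q) _]
    exact zero_le

theorem Sparse.translate {η : Measure (ColouredSpace d m)} (h : Sparse ρ η) (t : Space d) :
    Sparse ρ (translate t η) := by
  intro a
  have hm : Measurable fun p : ColouredSpace d m => (t + p.1, p.2) := by fun_prop
  rw [ColouredPointProcess.translate, Measure.map_apply hm (measurableSet_fst_ball a)]
  refine (measure_mono ?_).trans (h (a - t))
  intro p hp
  simp only [Set.mem_preimage, Metric.mem_ball, dist_eq_norm] at hp ⊢
  convert hp using 2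
  abel

theorem Sparse.colour {η : Measure (ColouredSpace d m)} (h : Sparse ρ η) (i : Fin m) :
    TranslationBounded ρ 1 (colour η i) := by
  intro a
  rw [ColouredPointProcess.colour, Measure.map_apply measurable_fst Metric.isOpen_ball.measurableSet]
  exact (Measure.restrict_apply_le _ _).trans (h a)

theorem Sparse.map_fst {η : Measure (ColouredSpace d m)} (h : Sparse ρ η) :
    TranslationBounded ρ 1 (η.map Prod.fst) := by
  intro a
  rw [Measure.map_apply measurable_fst Metric.isOpen_ball.measurableSet]
  exact h a

/-- The kernel that sends a sparse measure on `𝔼` to itself, and every other measure to `0`. -/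
noncomputable def sparseKernel (d m : ℕ) (ρ : ℝ) :
    Kernel (Measure (ColouredSpace d m)) (ColouredSpace d m) :=
  open scoped Classical in
  Kernel.piecewise (measurableSet_sparseSet (ρ := ρ)) ⟨id, measurable_id⟩ 0

theorem sparseKernel_of_mem {η : Measure (ColouredSpace d m)} (h : η ∈ sparseSet d m ρ) :
    sparseKernel d m ρ η = η := by
  classical
  rw [sparseKernel, Kernel.piecewise_apply, if_pos h]
  rfl

theorem sparseKernel_apply {η : Measure (ColouredSpace d m)} (h : Sparse ρ η) :
    sparseKernel d m ρ η = η := sparseKernel_of_mem h.mem_sparseSet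

theorem sparse_sparseKernel (hρ : 0 < ρ) (η : Measure (ColouredSpace d m)) :
    Sparse (ρ / 2) (sparseKernel d m ρ η) := by
  classical
  rw [sparseKernel, Kernel.piecewise_apply]
  split_ifs with h
  · exact sparse_of_mem_sparseSet hρ h
  · exact sparse_zero

/-- Make the exhausting sets disjoint: the kernel is the sum of its restrictions to them, each of
which is finite. -/
theorem isSFiniteKernel_of_forall_le {α β : Type*} [MeasurableSpace α] [MeasurableSpace β]
    (κ : Kernel α β) (s : ℕ → Set β) (hs : ∀ n, MeasurableSet (s n)) (hU : ⋃ n, s n = Set.univ)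
    (c : ℕ → ℝ≥0∞) (hc : ∀ n, c n < ∞) (h : ∀ n a, κ a (s n) ≤ c n) : IsSFiniteKernel κ := by
  have hm : ∀ n, MeasurableSet (disjointed s n) := fun n => MeasurableSet.disjointed hs n
  have : κ = Kernel.sum fun n => κ.restrict (hm n) := by
    ext a : 1
    rw [Kernel.sum_apply]
    simp_rw [Kernel.restrict_apply]
    rw [← Measure.restrict_iUnion (disjoint_disjointed s) hm, iUnion_disjointed, hU,
      Measure.restrict_univ]
  rw [this]
  have : ∀ n, IsFiniteKernel (κ.restrict (hm n)) := fun n => ⟨c n, hc n, fun a => by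
    rw [Kernel.restrict_apply, Measure.restrict_apply_univ]
    exact (measure_mono (disjointed_subset s n)).trans (h n a)⟩
  exact Kernel.isSFiniteKernel_sum

/-- Sending the remaining measures to `0` gives a bound on balls that is uniform in `η`. Fubini and
the measurability of fibre integrals rest on this s-finiteness. -/
theorem isSFiniteKernel_sparseKernel (hρ : 0 < ρ) : IsSFiniteKernel (sparseKernel d m ρ) := by
  refine isSFiniteKernel_of_forall_le _ (fun n => Prod.fst ⁻¹' Metric.ball 0 n)
    (fun n => measurableSet_fst_ball 0) ?_
    (fun n => 1 * (volume (Metric.ball (0 : Space d) (ρ / 2)))⁻¹ *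
      volume (Metric.ball (0 : Space d) (n + ρ / 2))) (fun n => ?_) (fun n η => ?_)
  · rw [← Set.preimage_iUnion, Metric.iUnion_ball_nat, Set.preimage_univ]
  · exact ENNReal.mul_lt_top (ENNReal.mul_lt_top ENNReal.one_lt_top
      (ENNReal.inv_lt_top.2 (Metric.measure_ball_pos volume _ (half_pos hρ)))) measure_ball_lt_top
  · have := (sparse_sparseKernel hρ η).map_fst.measure_ball_le (half_pos hρ) ENNReal.one_ne_top n
    rwa [Measure.map_apply measurable_fst Metric.isOpen_ball.measurableSet] at this

/-- The kernel `η ↦ η^i` on sparse measures. -/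
noncomputable def colourKernel (d : ℕ) {m : ℕ} (ρ : ℝ) (i : Fin m) :
    Kernel (Measure (ColouredSpace d m)) (Space d) :=
  ((sparseKernel d m ρ).restrict
    (measurable_snd (measurableSet_singleton i) : MeasurableSet {p : ColouredSpace d m | p.2 = i})).map
    Prod.fst

theorem isSFiniteKernel_colourKernel (hρ : 0 < ρ) (i : Fin m) :
    IsSFiniteKernel (colourKernel d ρ i) := by
  have := isSFiniteKernel_sparseKernel (d := d) (m := m) hρ
  unfold colourKernel
  infer_instance

theorem colourKernel_eq (η : Measure (ColouredSpace d m)) (i : Fin m) :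
    colourKernel d ρ i η = colour (sparseKernel d m ρ η) i := by
  rw [colourKernel, Kernel.map_apply _ measurable_fst, Kernel.restrict_apply, colour]
  rfl

theorem colourKernel_apply {η : Measure (ColouredSpace d m)} (h : Sparse ρ η) (i : Fin m) :
    colourKernel d ρ i η = colour η i := by
  rw [colourKernel_eq, sparseKernel_apply h]

theorem translationBounded_colourKernel (hρ : 0 < ρ) (η : Measure (ColouredSpace d m))
    (i : Fin m) : TranslationBounded (ρ / 2) 1 (colourKernel d ρ i η) := by
  rw [colourKernel_eq]
  exact (sparse_sparseKernel hρ η).colour i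

theorem measurable_translate (t : Space d) : Measurable (translate (m := m) t) :=
  Measure.measurable_map _ (by fun_prop)

theorem translate_translate (s t : Space d) (η : Measure (ColouredSpace d m)) :
    translate s (translate t η) = translate (s + t) η := by
  unfold translate
  rw [Measure.map_map (by fun_prop) (by fun_prop)]
  congr 1
  ext p : 2 <;> simp [add_assoc]

theorem colour_translate (t : Space d) (η : Measure (ColouredSpace d m)) (i : Fin m) :
    colour (translate t η) i = (colour η i).map (t + ·) := by
  unfold translate colour
  have hs : MeasurableSet {p : ColouredSpace d m | p.2 = i} :=
    measurable_snd (measurableSet_singleton i)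
  rw [Measure.restrict_map (by fun_prop) hs, Measure.map_map (by fun_prop) (by fun_prop),
    Measure.map_map (by fun_prop) (by fun_prop)]
  rfl

/-- `(η, x) ↦ T_{-x} η` for sparse `η`. -/
noncomputable def recentre (d m : ℕ) (ρ : ℝ) (q : Measure (ColouredSpace d m) × Space d) :
    Measure (ColouredSpace d m) := translate (-q.2) (sparseKernel d m ρ q.1)

/-- Joint measurability in configuration and point: the mass of a fixed set `A` is the kernel mass
of a section of a measurable set, which depends measurably on the parameters. -/
theorem measurable_recentre (hρ : 0 < ρ) : Measurable (recentre d m ρ) := by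
  have := isSFiniteKernel_sparseKernel (d := d) (m := m) hρ
  refine Measure.measurable_of_measurable_coe _ fun A hA => ?_
  have h1 : Measurable fun z : (Measure (ColouredSpace d m) × Space d) × ColouredSpace d m =>
      ((-z.1.2 + z.2.1, z.2.2) : ColouredSpace d m) := by fun_prop
  have h2 := Kernel.measurable_kernel_prodMk_left
    (κ := Kernel.prodMkRight (Space d) (sparseKernel d m ρ)) (h1 hA)
  have h3 : (fun q : Measure (ColouredSpace d m) × Space d => recentre d m ρ q A) = fun q =>
      Kernel.prodMkRight (Space d) (sparseKernel d m ρ) q (Prod.mk q ⁻¹'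
        ((fun z : (Measure (ColouredSpace d m) × Space d) × ColouredSpace d m =>
      ((-z.1.2 + z.2.1, z.2.2) : ColouredSpace d m)) ⁻¹' A)) := by
    ext q
    rw [recentre, translate, Measure.map_apply (by fun_prop) hA, Kernel.prodMkRight_apply]
    rfl
  rw [h3]
  exact h2

end Sparse

end ColouredPointProcess

namespace ColouredPointProcess

open ProbabilityTheory

/-! ### Cubes. -/

section Cube

variable {d : ℕ}

theorem isOpen_cube (R : ℝ) : IsOpen (cube d R) := by
  have : cube d R = ⋂ j, {x : Space d | |x j| < R / 2} := by ext; simp [cube]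
  rw [this]
  exact isOpen_iInter_of_finite fun j => isOpen_lt (by fun_prop) continuous_const

theorem measurableSet_cube (R : ℝ) : MeasurableSet (cube d R) := (isOpen_cube R).measurableSet

theorem volume_cube (R : ℝ) : volume (cube d R) = ENNReal.ofReal R ^ d := by
  have h : cube d R = (MeasurableEquiv.toLp 2 (Fin d → ℝ)).symm ⁻¹'
      Set.pi Set.univ fun _ => Set.Ioo (-(R / 2)) (R / 2) := by
    ext x
    simp [cube, abs_lt, Set.mem_pi]
  rw [h, (EuclideanSpace.volume_preserving_symm_measurableEquiv_toLp (Fin d)).measure_preimage_equiv,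
    Real.volume_pi_Ioo]
  simp

theorem volume_real_cube {R : ℝ} (hR : 0 ≤ R) : volume.real (cube d R) = R ^ d := by
  rw [Measure.real, volume_cube, ENNReal.toReal_pow, ENNReal.toReal_ofReal hR]

theorem norm_le_of_mem_cube {R : ℝ} (hR : 0 ≤ R) {x : Space d} (hx : x ∈ cube d R) :
    ‖x‖ ≤ d * R := by
  refine abs_le_of_sq_le_sq' ?_ (by positivity) |>.2
  rw [EuclideanSpace.norm_sq_eq]
  calc ∑ j, ‖x j‖ ^ 2 ≤ ∑ _j : Fin d, R ^ 2 := by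
        refine Finset.sum_le_sum fun j _ => ?_
        have := hx j
        rw [Real.norm_eq_abs]
        exact pow_le_pow_left₀ (abs_nonneg _) (by linarith) 2
    _ = d * R ^ 2 := by simp
    _ ≤ (d * R) ^ 2 := by
        rw [mul_pow]
        gcongr
        exact_mod_cast Nat.le_self_pow two_ne_zero d

end Cube

/-! ### Palm measures and the refined Campbell formula. -/

section Campbell

variable {d m : ℕ} {ρ : ℝ} {μ : Measure (Measure (ColouredSpace d m))}

theorem measurable_map_recentre (hρ : 0 < ρ) (i : Fin m) :
    Measurable fun η : Measure (ColouredSpace d m) =>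
      ((colourKernel d ρ i η).restrict (cube d 1)).map fun x => recentre d m ρ (η, x) := by
  have := isSFiniteKernel_colourKernel (d := d) hρ i
  have hr := measurable_recentre (d := d) (m := m) hρ
  refine Measure.measurable_of_measurable_coe _ fun A hA => ?_
  have h : MeasurableSet {q : Measure (ColouredSpace d m) × Space d |
      recentre d m ρ q ∈ A ∧ q.2 ∈ cube d 1} :=
    (hr hA).inter (measurable_snd (measurableSet_cube 1))
  convert Kernel.measurable_kernel_prodMk_left (κ := colourKernel d ρ i) h using 2 with η
  have hη : Measurable fun x => recentre d m ρ (η, x) := hr.comp measurable_prodMk_left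
  rw [Measure.map_apply hη hA, Measure.restrict_apply (hη hA)]
  rfl

/-- Integration against a `bind` needs a measurable map. On sparse configurations, hence almost
surely, the map in `palm` coincides with a kernel version that is measurable everywhere. -/
theorem palm_eq_bind (hs : ∀ᵐ η ∂μ, Sparse ρ η) (i : Fin m) :
    palm μ i = μ.bind fun η : Measure (ColouredSpace d m) =>
      ((colourKernel d ρ i η).restrict (cube d 1)).map fun x => recentre d m ρ (η, x) := by
  refine Measure.bind_congr_right ?_
  filter_upwards [hs] with η hη
  simp only [colourKernel_apply hη, recentre, sparseKernel_apply hη]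

theorem lintegral_palm (hρ : 0 < ρ) (hs : ∀ᵐ η ∂μ, Sparse ρ η) (i : Fin m)
    {F : Measure (ColouredSpace d m) → ℝ≥0∞} (hF : Measurable F) :
    ∫⁻ ζ, F ζ ∂(palm μ i) =
      ∫⁻ η, ∫⁻ x in cube d 1, F (recentre d m ρ (η, x)) ∂(colourKernel d ρ i η) ∂μ := by
  have hr := measurable_recentre (d := d) (m := m) hρ
  rw [palm_eq_bind hs, Measure.lintegral_bind (measurable_map_recentre hρ i).aemeasurable
    hF.aemeasurable]
  exact lintegral_congr fun η => lintegral_map hF (hr.comp measurable_prodMk_left)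

theorem isFiniteMeasure_palm [IsProbabilityMeasure μ] (hρ : 0 < ρ) (hs : ∀ᵐ η ∂μ, Sparse ρ η)
    (i : Fin m) : IsFiniteMeasure (palm μ i) := by
  refine ⟨?_⟩
  rw [← lintegral_one, lintegral_palm hρ hs i measurable_const]
  have hb : ∀ η : Measure (ColouredSpace d m), ∫⁻ x in cube d 1, 1 ∂(colourKernel d ρ i η) ≤
      1 * (volume (Metric.ball (0 : Space d) (ρ / 2)))⁻¹ *
      volume (Metric.ball (0 : Space d) (d + 1 + ρ / 2)) := fun η => by
    rw [setLIntegral_one]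
    refine (measure_mono ?_).trans ((translationBounded_colourKernel hρ η i).measure_ball_le
      (half_pos hρ) ENNReal.one_ne_top (d + 1))
    intro x hx
    rw [mem_ball_zero_iff]
    linarith [norm_le_of_mem_cube zero_le_one hx]
  refine (lintegral_mono hb).trans_lt ?_
  rw [lintegral_const, measure_univ, mul_one]
  exact ENNReal.mul_lt_top (ENNReal.mul_lt_top ENNReal.one_lt_top
      (ENNReal.inv_lt_top.2 (Metric.measure_ball_pos volume _ (half_pos hρ)))) measure_ball_lt_top

/-- Palm configurations are translates of configurations of the process, and translation preserves
sparseness. -/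
theorem ae_palm_mem_sparseSet (hρ : 0 < ρ) (hs : ∀ᵐ η ∂μ, Sparse ρ η) (i : Fin m) :
    ∀ᵐ ζ ∂(palm μ i), ζ ∈ sparseSet d m ρ := by
  have hr := measurable_recentre (d := d) (m := m) hρ
  have h0 : palm μ i (sparseSet d m ρ)ᶜ = 0 := by
    rw [← lintegral_indicator_one measurableSet_sparseSet.compl,
      lintegral_palm hρ hs i (measurable_one.indicator measurableSet_sparseSet.compl)]
    refine (lintegral_congr_ae ?_).trans lintegral_zero
    filter_upwards [hs] with η hη
    refine (lintegral_congr fun x => ?_).trans lintegral_zero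
    refine Set.indicator_of_notMem ?_ _
    rw [Set.notMem_compl_iff, recentre, sparseKernel_apply hη]
    exact (hη.translate _).mem_sparseSet
  filter_upwards [compl_mem_ae_iff.2 h0] with ζ hζ
  simpa using hζ

/-- The refined Campbell formula. -/
theorem lintegral_campbell [IsProbabilityMeasure μ] (hρ : 0 < ρ) (hs : ∀ᵐ η ∂μ, Sparse ρ η)
    (hst : ∀ t, μ.map (translate t) = μ) (i : Fin m)
    {g : Space d × Measure (ColouredSpace d m) → ℝ≥0∞} (hg : Measurable g) :
    ∫⁻ η, ∫⁻ x, g (x, recentre d m ρ (η, x)) ∂(colourKernel d ρ i η) ∂μ =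
      ∫⁻ ζ, ∫⁻ x, g (x, ζ) ∂volume ∂(palm μ i) := by
  have := isSFiniteKernel_colourKernel (d := d) hρ i
  have hr := measurable_recentre (d := d) (m := m) hρ
  -- The unit cube provides a weight with `∫ c (x - a) da = 1` for every `x`. Inserting it, shifting
  -- the configuration by `a` under `μ` and integrating `a` out replaces the sum over all points by
  -- the sum over the points in `C_1`.
  set c : Space d → ℝ≥0∞ := (cube d 1).indicator 1 with hc_def
  have hc : Measurable c := measurable_one.indicator (measurableSet_cube 1)
  have hc1 : ∀ x, ∫⁻ a, c (x - a) = 1 := fun x => by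
    rw [lintegral_sub_left_eq_self c x, hc_def, lintegral_indicator_one (measurableSet_cube 1),
      volume_cube]
    simp
  have hm : Measurable fun q : (Measure (ColouredSpace d m) × Space d) × Space d =>
      c (q.2 - q.1.2) * g (q.2, recentre d m ρ (q.1.1, q.2)) := by
    refine (hc.comp (by fun_prop)).mul (hg.comp (measurable_snd.prodMk (hr.comp ?_)))
    fun_prop
  have hm' : Measurable fun q : (Measure (ColouredSpace d m) × Space d) × Space d =>
      c q.2 * g (q.1.2 + q.2, recentre d m ρ (q.1.1, q.2)) := by
    refine (hc.comp (by fun_prop)).mul (hg.comp (Measurable.prodMk (by fun_prop) (hr.comp ?_)))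
    fun_prop
  have hK : Measurable fun q : Measure (ColouredSpace d m) × Space d =>
      ∫⁻ x, c (x - q.2) * g (x, recentre d m ρ (q.1, x)) ∂(colourKernel d ρ i q.1) :=
    Measurable.lintegral_kernel_prod_right' (κ := Kernel.prodMkRight (Space d)
      (colourKernel d ρ i)) hm
  have hK' : Measurable fun q : Measure (ColouredSpace d m) × Space d =>
      ∫⁻ x, c x * g (q.2 + x, recentre d m ρ (q.1, x)) ∂(colourKernel d ρ i q.1) :=
    Measurable.lintegral_kernel_prod_right' (κ := Kernel.prodMkRight (Space d)
      (colourKernel d ρ i)) hm'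
  have hsf : ∀ η, SFinite (colourKernel d ρ i η) := fun η => inferInstance
  calc ∫⁻ η, ∫⁻ x, g (x, recentre d m ρ (η, x)) ∂(colourKernel d ρ i η) ∂μ
      = ∫⁻ η, ∫⁻ x, ∫⁻ a, c (x - a) * g (x, recentre d m ρ (η, x)) ∂volume
          ∂(colourKernel d ρ i η) ∂μ := by
        refine lintegral_congr fun η => lintegral_congr fun x => ?_
        rw [lintegral_mul_const _ (show Measurable fun a => c (x - a) from
          hc.comp (measurable_const.sub measurable_id)), hc1, one_mul]
    _ = ∫⁻ η, ∫⁻ a, ∫⁻ x, c (x - a) * g (x, recentre d m ρ (η, x))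
          ∂(colourKernel d ρ i η) ∂volume ∂μ := by
        refine lintegral_congr fun η => lintegral_lintegral_swap ?_
        exact (hm.comp (show Measurable fun p : Space d × Space d => ((η, p.2), p.1) by
          fun_prop)).aemeasurable
    _ = ∫⁻ a, ∫⁻ η, ∫⁻ x, c (x - a) * g (x, recentre d m ρ (η, x))
          ∂(colourKernel d ρ i η) ∂μ := lintegral_lintegral_swap hK.aemeasurable
    _ = ∫⁻ a, ∫⁻ η, ∫⁻ x, c x * g (a + x, recentre d m ρ (η, x))
          ∂(colourKernel d ρ i η) ∂μ := by
        refine lintegral_congr fun a => ?_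
        have hKa : Measurable fun η => ∫⁻ x, c (x - a) * g (x, recentre d m ρ (η, x))
            ∂(colourKernel d ρ i η) := hK.comp (measurable_prodMk_right (y := a))
        -- Stationarity: passing to the image of `μ` under `translate a` moves the points by `a` and
        -- leaves the recentred configurations unchanged.
        conv_lhs => rw [← hst a]
        rw [lintegral_map hKa (measurable_translate a)]
        refine lintegral_congr_ae ?_
        filter_upwards [hs] with η hη
        have hma : Measurable fun x =>
            c (x - a) * g (x, recentre d m ρ (translate a η, x)) :=
          hm.comp (show Measurable fun x : Space d => ((translate a η, a), x) by fun_prop)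
        rw [colourKernel_apply (hη.translate a), colourKernel_apply hη, colour_translate,
          lintegral_map hma (by fun_prop)]
        refine lintegral_congr fun x => ?_
        simp only [recentre, sparseKernel_apply (hη.translate a), sparseKernel_apply hη,
          translate_translate]
        congr 3
        · abel
        · congr 1; abel
    _ = ∫⁻ η, ∫⁻ a, ∫⁻ x, c x * g (a + x, recentre d m ρ (η, x))
          ∂(colourKernel d ρ i η) ∂volume ∂μ := (lintegral_lintegral_swap hK'.aemeasurable).symm
    _ = ∫⁻ η, ∫⁻ x, ∫⁻ a, c x * g (a + x, recentre d m ρ (η, x)) ∂volume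
          ∂(colourKernel d ρ i η) ∂μ := by
        refine lintegral_congr fun η => (lintegral_lintegral_swap
          (f := fun x a => c x * g (a + x, recentre d m ρ (η, x))) ?_).symm
        exact (hm'.comp (show Measurable fun p : Space d × Space d => ((η, p.2), p.1) by
          fun_prop)).aemeasurable
    _ = ∫⁻ η, ∫⁻ x in cube d 1, ∫⁻ a, g (a, recentre d m ρ (η, x)) ∂volume
          ∂(colourKernel d ρ i η) ∂μ := by
        refine lintegral_congr fun η => ?_
        rw [← lintegral_indicator (measurableSet_cube 1)]
        refine lintegral_congr fun x => ?_
        rw [lintegral_add_right_eq_self (fun a => c x * g (a, recentre d m ρ (η, x))) x]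
        by_cases hx : x ∈ cube d 1
        · simp [hc_def, hx]
        · simp [hc_def, hx]
    _ = ∫⁻ ζ, ∫⁻ x, g (x, ζ) ∂volume ∂(palm μ i) :=
        (lintegral_palm hρ hs i (Measurable.lintegral_prod_left' hg)).symm

end Campbell

end ColouredPointProcess

namespace ColouredPointProcess

open ProbabilityTheory

/-! ### Integrability of functions with the decay of `weight`. -/

section Weight

variable {d m : ℕ} {ρ B : ℝ} {K : ℝ≥0∞} {ν : Measure (Space d)}

theorem TranslationBounded.integrable_weight (h : TranslationBounded ρ K ν) (hρ : 0 < ρ)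
    (hK : K ≠ ∞) (b : Space d) : Integrable (fun x => weight (x - b)) ν := by
  refine ⟨(continuous_weight.comp (by fun_prop)).aestronglyMeasurable, ?_⟩
  rw [hasFiniteIntegral_iff_ofReal (Eventually.of_forall fun x => (weight_pos _).le)]
  exact (h.lintegral_weight_le hρ hK b).trans_lt (weightBound_ne_top hρ hK).lt_top

theorem TranslationBounded.integral_weight_le (h : TranslationBounded ρ K ν) (hρ : 0 < ρ)
    (hK : K ≠ ∞) (b : Space d) : ∫ x, weight (x - b) ∂ν ≤ (weightBound d ρ K).toReal := by
  rw [integral_eq_lintegral_of_nonneg_ae (Eventually.of_forall fun x => (weight_pos _).le)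
    (continuous_weight.comp (by fun_prop)).aestronglyMeasurable]
  exact ENNReal.toReal_mono (weightBound_ne_top hρ hK) (h.lintegral_weight_le hρ hK b)

theorem TranslationBounded.integrable (h : TranslationBounded ρ K ν) (hρ : 0 < ρ)
    (hK : K ≠ ∞) {f : Space d → ℂ} (hf : AEStronglyMeasurable f ν) {b : Space d}
    (hB : ∀ x, ‖f x‖ ≤ B * weight (x - b)) : Integrable f ν :=
  ((h.integrable_weight hρ hK b).const_mul B).mono' hf (Eventually.of_forall hB)

theorem nonneg_of_norm_le_weight {f : Space d → ℂ} {b : Space d}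
    (hB : ∀ x, ‖f x‖ ≤ B * weight (x - b)) : 0 ≤ B :=
  nonneg_of_mul_nonneg_left ((norm_nonneg _).trans (hB 0)) (weight_pos _)

theorem TranslationBounded.integral_norm_le (h : TranslationBounded ρ K ν) (hρ : 0 < ρ)
    (hK : K ≠ ∞) {f : Space d → ℂ} {b : Space d} (hB : ∀ x, ‖f x‖ ≤ B * weight (x - b)) :
    ∫ x, ‖f x‖ ∂ν ≤ B * (weightBound d ρ K).toReal := by
  have hB0 := nonneg_of_norm_le_weight hB
  calc ∫ x, ‖f x‖ ∂ν ≤ ∫ x, B * weight (x - b) ∂ν :=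
        integral_mono_of_nonneg (Eventually.of_forall fun _ => norm_nonneg _)
          ((h.integrable_weight hρ hK b).const_mul B) (Eventually.of_forall hB)
    _ ≤ B * (weightBound d ρ K).toReal := by
        rw [integral_const_mul]
        gcongr
        exact h.integral_weight_le hρ hK b

theorem translationBounded_volume :
    TranslationBounded 1 (volume (Metric.ball (0 : Space d) 1)) (volume : Measure (Space d)) :=
  fun a => (Measure.addHaar_ball_center volume a 1).le

theorem integrable_of_norm_le_weight {f : Space d → ℂ} (hf : AEStronglyMeasurable f volume)
    {b : Space d} (hB : ∀ x, ‖f x‖ ≤ B * weight (x - b)) : Integrable f volume :=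
  translationBounded_volume.integrable one_pos measure_ball_lt_top.ne hf hB

theorem TranslationBounded.hasTemperateGrowth (h : TranslationBounded ρ K ν) (hρ : 0 < ρ)
    (hK : K ≠ ∞) : ν.HasTemperateGrowth :=
  ⟨⟨d + 1, by simpa [weight] using h.integrable_weight hρ hK 0⟩⟩

/-- The supremum of Schwartz seminorms that controls the decay of a function like `weight`. -/
theorem norm_le_seminorm_mul_weight (f : 𝓢(Space d, ℂ)) (x : Space d) :
    ‖f x‖ ≤ 2 ^ (d + 1) * (Finset.Iic ((d + 1, 0) : ℕ × ℕ)).sup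
      (fun p => SchwartzMap.seminorm ℂ p.1 p.2) f * weight x := by
  have h := SchwartzMap.one_add_le_sup_seminorm_apply (𝕜 := ℂ) (m := (d + 1, 0)) le_rfl le_rfl f x
  rw [norm_iteratedFDeriv_zero] at h
  rw [weight, Real.rpow_neg (by positivity), ← div_eq_mul_inv, le_div_iff₀ (by positivity)]
  have hd : (1 + ‖x‖) ^ (d + 1 : ℝ) = (1 + ‖x‖) ^ (d + 1) := by
    rw [← Real.rpow_natCast]
    push_cast
    rfl
  rw [mul_comm, hd]
  exact h

theorem exists_norm_le_weight (f : 𝓢(Space d, ℂ)) : ∃ B, ∀ x, ‖f x‖ ≤ B * weight x :=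
  ⟨_, norm_le_seminorm_mul_weight f⟩

end Weight

/-! ### Weighted counts: bounds, measurability, algebra. -/

section Count

variable {d m : ℕ} {ρ B : ℝ} (w : Fin m → ℝ)

theorem integrable_colour {η : Measure (ColouredSpace d m)} (hη : Sparse ρ η) (hρ : 0 < ρ)
    {f : Space d → ℂ} (hf : Measurable f) {b : Space d} (hB : ∀ x, ‖f x‖ ≤ B * weight (x - b))
    (i : Fin m) : Integrable f (colour η i) :=
  (hη.colour i).integrable hρ ENNReal.one_ne_top hf.aestronglyMeasurable hB

theorem norm_weightedCount_le {η : Measure (ColouredSpace d m)} (hη : Sparse ρ η) (hρ : 0 < ρ)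
    {f : Space d → ℂ} {b : Space d} (hB : ∀ x, ‖f x‖ ≤ B * weight (x - b)) :
    ‖weightedCount w f η‖ ≤ (∑ i, |w i|) * (B * (weightBound d ρ 1).toReal) := by
  rw [weightedCount, Finset.sum_mul]
  refine norm_sum_le_of_le _ fun i _ => ?_
  rw [norm_mul, Complex.norm_real, Real.norm_eq_abs]
  gcongr
  exact (norm_integral_le_integral_norm _).trans
    ((hη.colour i).integral_norm_le hρ ENNReal.one_ne_top hB)

/-- The parameter in `α` accommodates the shift in `g (x + ·)`, which occurs in the second moments.
-/
theorem stronglyMeasurable_weightedCount_sparseKernel {α : Type*} [MeasurableSpace α] (hρ : 0 < ρ)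
    {f : α × Space d → ℂ} (hf : Measurable f) :
    StronglyMeasurable fun q : α × Measure (ColouredSpace d m) =>
      weightedCount w (fun x => f (q.1, x)) (sparseKernel d m ρ q.2) := by
  have h := fun i : Fin m => isSFiniteKernel_colourKernel (d := d) hρ i
  have hi : ∀ i : Fin m, StronglyMeasurable fun q : α × Measure (ColouredSpace d m) =>
      ∫ x, f (q.1, x) ∂(Kernel.prodMkLeft α (colourKernel d ρ i) q) := fun i =>
    StronglyMeasurable.integral_kernel_prod_right'
      (f := fun p : (α × Measure (ColouredSpace d m)) × Space d => f (p.1.1, p.2))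
      (hf.comp (by fun_prop)).stronglyMeasurable
  simp only [Kernel.prodMkLeft_apply, colourKernel_eq] at hi
  unfold weightedCount
  exact Finset.stronglyMeasurable_fun_sum _ fun i _ => (hi i).const_mul _

theorem stronglyMeasurable_weightedCount_sparseKernel_const (hρ : 0 < ρ)
    {f : Space d → ℂ} (hf : Measurable f) :
    StronglyMeasurable fun η : Measure (ColouredSpace d m) =>
      weightedCount w f (sparseKernel d m ρ η) := by
  have h := stronglyMeasurable_weightedCount_sparseKernel (d := d) w hρ (α := Unit)
    (f := fun p : Unit × Space d => f p.2) (hf.comp measurable_snd)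
  exact h.comp_measurable (g := fun η => ((), η)) measurable_prodMk_left

theorem aestronglyMeasurable_weightedCount {P : Measure (Measure (ColouredSpace d m))}
    (hP : ∀ᵐ η ∂P, η ∈ sparseSet d m ρ) (hρ : 0 < ρ) {f : Space d → ℂ} (hf : Measurable f) :
    AEStronglyMeasurable (weightedCount w f) P := by
  refine ⟨_, stronglyMeasurable_weightedCount_sparseKernel_const w hρ hf, ?_⟩
  filter_upwards [hP] with η hη
  rw [sparseKernel_of_mem hη]

theorem memLp_top_weightedCount {P : Measure (Measure (ColouredSpace d m))}
    (hP : ∀ᵐ η ∂P, η ∈ sparseSet d m ρ) (hρ : 0 < ρ) {f : Space d → ℂ} (hf : Measurable f)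
    {b : Space d} (hB : ∀ x, ‖f x‖ ≤ B * weight (x - b)) :
    MemLp (weightedCount w f) ∞ P := by
  refine memLp_top_of_bound (aestronglyMeasurable_weightedCount w hP hρ hf)
    ((∑ i, |w i|) * (B * (weightBound d (ρ / 2) 1).toReal)) ?_
  filter_upwards [hP] with η hη
  exact norm_weightedCount_le w (sparse_of_mem_sparseSet hρ hη) (half_pos hρ) hB

theorem weightedCount_add {η : Measure (ColouredSpace d m)} (hη : Sparse ρ η) (hρ : 0 < ρ)
    (f g : 𝓢(Space d, ℂ)) :
    weightedCount w (fun x => f x + g x) η = weightedCount w f η + weightedCount w g η := by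
  have hi : ∀ (h : 𝓢(Space d, ℂ)) i, Integrable h (colour η i) := fun h i =>
    have := (hη.colour i).hasTemperateGrowth hρ ENNReal.one_ne_top
    h.integrable
  unfold weightedCount
  rw [← Finset.sum_add_distrib]
  refine Finset.sum_congr rfl fun i _ => ?_
  rw [integral_add (hi f i) (hi g i), mul_add]

theorem weightedCount_const_mul (η : Measure (ColouredSpace d m)) (c : ℂ) (f : Space d → ℂ) :
    weightedCount w (fun x => c * f x) η = c * weightedCount w f η := by
  unfold weightedCount
  rw [Finset.mul_sum]
  refine Finset.sum_congr rfl fun i _ => ?_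
  rw [integral_const_mul]
  ring

theorem weightedCount_conj (η : Measure (ColouredSpace d m)) (f : Space d → ℂ) :
    weightedCount w (fun x => starRingEnd ℂ (f x)) η = starRingEnd ℂ (weightedCount w f η) := by
  unfold weightedCount
  rw [map_sum]
  refine Finset.sum_congr rfl fun i _ => ?_
  rw [integral_conj, map_mul, Complex.conj_ofReal]

theorem weightedCount_translate (η : Measure (ColouredSpace d m)) (t : Space d)
    (f : Space d → ℂ) :
    weightedCount w f (translate t η) = weightedCount w (fun x => f (t + x)) η := by
  unfold weightedCount
  refine Finset.sum_congr rfl fun i _ => ?_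
  rw [colour_translate]
  congr 1
  exact (MeasurableEquiv.addLeft t).measurableEmbedding.integral_map f

end Count

end ColouredPointProcess

namespace ColouredPointProcess

open ProbabilityTheory

/-! ### Second moments through the Palm measure. -/

section SecondMoment

variable {d m : ℕ} {ρ B : ℝ} {μ : Measure (Measure (ColouredSpace d m))} (w : Fin m → ℝ)

/-- The Campbell formula as an identity of measures, the form that applies to complex integrands. -/
theorem map_compProd_recentre [IsProbabilityMeasure μ] (hρ : 0 < ρ) (hs : ∀ᵐ η ∂μ, Sparse ρ η)
    (hst : ∀ t, μ.map (translate t) = μ) (i : Fin m) :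
    (μ ⊗ₘ colourKernel d ρ i).map (fun q => (q.2, recentre d m ρ q)) =
      volume.prod (palm μ i) := by
  have := isSFiniteKernel_colourKernel (d := d) hρ i
  have := isFiniteMeasure_palm hρ hs i
  have hr := measurable_recentre (d := d) (m := m) hρ
  have hm : Measurable fun q : Measure (ColouredSpace d m) × Space d =>
      (q.2, recentre d m ρ q) := measurable_snd.prodMk hr
  ext A hA
  have hi : Measurable (A.indicator (1 : Space d × Measure (ColouredSpace d m) → ℝ≥0∞)) :=
    measurable_one.indicator hA
  rw [← lintegral_indicator_one hA, ← lintegral_indicator_one hA, lintegral_map hi hm,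
    Measure.lintegral_compProd (show Measurable fun q : Measure (ColouredSpace d m) × Space d =>
      A.indicator 1 (q.2, recentre d m ρ q) from hi.comp hm), lintegral_prod_symm' _ hi]
  exact lintegral_campbell hρ hs hst i hi

variable {f g : Space d → ℂ} {Bf Bg : ℝ}

/-- The integral over `z` is bounded uniformly in `x`, since translates of `weight` have uniformly
bounded `ν`-integral; the remaining factor `f` is Lebesgue integrable. -/
theorem integrable_correlation {ν : Measure (Space d)} {K : ℝ≥0∞}
    (hν : TranslationBounded ρ K ν) (hρ : 0 < ρ) (hK : K ≠ ∞)
    (hf : Continuous f) (hg : Continuous g)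
    (hBf : ∀ x, ‖f x‖ ≤ Bf * weight x) (hBg : ∀ x, ‖g x‖ ≤ Bg * weight x) :
    Integrable (fun p : Space d × Space d => f p.1 * starRingEnd ℂ (g (p.1 + p.2)))
      (volume.prod ν) := by
  have := hν.isLocallyFiniteMeasure hρ hK
  have hmeas : AEStronglyMeasurable
      (fun p : Space d × Space d => f p.1 * starRingEnd ℂ (g (p.1 + p.2))) (volume.prod ν) := by
    have : Continuous fun p : Space d × Space d => f p.1 * starRingEnd ℂ (g (p.1 + p.2)) :=
      (hf.comp continuous_fst).mul (Complex.continuous_conj.comp (hg.comp (by fun_prop)))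
    exact this.aestronglyMeasurable
  have hB : ∀ x z, ‖starRingEnd ℂ (g (x + z))‖ ≤ Bg * weight (z - -x) := fun x z => by
    rw [RCLike.norm_conj, sub_neg_eq_add, add_comm z x]
    exact hBg _
  have hint : ∀ x, Integrable (fun z => starRingEnd ℂ (g (x + z))) ν := fun x =>
    hν.integrable hρ hK
      (Complex.continuous_conj.comp (hg.comp (by fun_prop))).aestronglyMeasurable (hB x)
  rw [integrable_prod_iff hmeas]
  refine ⟨Eventually.of_forall fun x => (hint x).const_mul (f x), ?_⟩
  have hfi : Integrable f volume :=
    integrable_of_norm_le_weight hf.aestronglyMeasurable (b := 0) (by simpa using hBf)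
  refine (hfi.norm.mul_const (Bg * (weightBound d ρ K).toReal)).mono'
    hmeas.norm.integral_prod_right' (Eventually.of_forall fun x => ?_)
  rw [Real.norm_of_nonneg (integral_nonneg fun _ => norm_nonneg _)]
  simp_rw [norm_mul]
  rw [integral_const_mul]
  gcongr
  exact hν.integral_norm_le hρ hK (hB x)

/-- Integrating correlations of the translates of a point configuration. -/
theorem integral_mul_conj_weightedCount {ζ : Measure (ColouredSpace d m)} (hζ : Sparse ρ ζ)
    (hρ : 0 < ρ) (hf : Continuous f) (hg : Continuous g)
    (hBf : ∀ x, ‖f x‖ ≤ Bf * weight x) (hBg : ∀ x, ‖g x‖ ≤ Bg * weight x) :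
    ∫ x, f x * starRingEnd ℂ (weightedCount w (fun z => g (x + z)) ζ) =
      weightedCount w (fun z => ∫ x, f x * starRingEnd ℂ (g (x + z))) ζ := by
  have hi : ∀ i, Integrable (fun p : Space d × Space d => f p.1 * starRingEnd ℂ (g (p.1 + p.2)))
      (volume.prod (colour ζ i)) := fun i =>
    integrable_correlation (hζ.colour i) hρ ENNReal.one_ne_top hf hg hBf hBg
  have := fun i => (hζ.colour i).isLocallyFiniteMeasure hρ ENNReal.one_ne_top
  simp_rw [← weightedCount_conj, weightedCount, Finset.mul_sum]
  rw [integral_finsetSum]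
  · refine Finset.sum_congr rfl fun i _ => ?_
    rw [← integral_integral_swap (hi i), ← integral_const_mul]
    refine integral_congr_ae (Eventually.of_forall fun x => ?_)
    simp only
    rw [integral_const_mul]
    ring
  · intro i _
    have := (hi i).integral_prod_left.const_mul (w i : ℂ)
    refine this.congr (Eventually.of_forall fun x => ?_)
    simp only
    rw [integral_const_mul]
    ring

/-- The second moments of a stationary process are given by its Palm measure. -/
theorem integral_weightedCount_mul_conj [IsProbabilityMeasure μ] (hρ : 0 < ρ)
    (hs : ∀ᵐ η ∂μ, Sparse ρ η) (hst : ∀ t, μ.map (translate t) = μ)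
    (hf : Continuous f) (hg : Continuous g)
    (hBf : ∀ x, ‖f x‖ ≤ Bf * weight x) (hBg : ∀ x, ‖g x‖ ≤ Bg * weight x) :
    ∫ η, weightedCount w f η * starRingEnd ℂ (weightedCount w g η) ∂μ =
      weightedFirstMoment μ w fun z => ∫ x, f x * starRingEnd ℂ (g (x + z)) := by
  have hfi : Integrable f volume :=
    integrable_of_norm_le_weight hf.aestronglyMeasurable (b := 0) (by simpa using hBf)
  have hr := measurable_recentre (d := d) (m := m) hρ
  have hm : Measurable fun q : Measure (ColouredSpace d m) × Space d =>
      (q.2, recentre d m ρ q) := measurable_snd.prodMk hr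
  have hsK := fun i : Fin m => isSFiniteKernel_colourKernel (d := d) hρ i
  have hfin := isFiniteMeasure_palm (μ := μ) hρ hs
  -- At `ζ = T_{-x} η` the shift of `g` undoes the recentring, so `F` becomes `f x` times the
  -- conjugate of the count of `g` in `η`.
  set F : Space d × Measure (ColouredSpace d m) → ℂ := fun q =>
    f q.1 * starRingEnd ℂ (weightedCount w (fun z => g (q.1 + z)) (sparseKernel d m ρ q.2))
    with hF
  have hFm : StronglyMeasurable F := by
    refine (hf.measurable.comp measurable_fst).stronglyMeasurable.mul ?_
    exact Complex.continuous_conj.comp_stronglyMeasurable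
      (stronglyMeasurable_weightedCount_sparseKernel w hρ (f := fun p => g (p.1 + p.2))
        (hg.measurable.comp (by fun_prop)))
  have hFi : ∀ i, Integrable F (volume.prod (palm μ i)) := by
    intro i
    refine ((hfi.norm.mul_const
      ((∑ i, |w i|) * (Bg * (weightBound d (ρ / 2) 1).toReal))).comp_fst (palm μ i)).mono'
      hFm.aestronglyMeasurable (Eventually.of_forall fun q => ?_)
    rw [hF, norm_mul, RCLike.norm_conj]
    gcongr
    refine norm_weightedCount_le w (sparse_sparseKernel hρ _) (half_pos hρ) (b := -q.1) fun z => ?_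
    rw [sub_neg_eq_add, add_comm z]
    exact hBg _
  have hFi' : ∀ i, Integrable (fun q => F (q.2, recentre d m ρ q)) (μ ⊗ₘ colourKernel d ρ i) := by
    intro i
    have := hFi i
    rw [← map_compProd_recentre hρ hs hst i] at this
    exact this.comp_measurable hm
  have h1 : ∀ᵐ η ∂μ, weightedCount w f η * starRingEnd ℂ (weightedCount w g η) =
      ∑ i, (w i : ℂ) * ∫ x, F (x, recentre d m ρ (η, x)) ∂(colourKernel d ρ i η) := by
    filter_upwards [hs] with η hη
    rw [weightedCount, Finset.sum_mul]
    refine Finset.sum_congr rfl fun i _ => ?_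
    rw [colourKernel_apply hη, mul_assoc, ← integral_mul_const]
    congr 1
    refine integral_congr_ae (Eventually.of_forall fun x => ?_)
    simp only [hF, recentre, sparseKernel_apply hη, sparseKernel_apply (hη.translate _),
      weightedCount_translate, add_neg_cancel_left]
  rw [integral_congr_ae h1, integral_finsetSum]
  · rw [weightedFirstMoment, weightedPalmIntegral]
    refine Finset.sum_congr rfl fun i _ => ?_
    rw [integral_const_mul, ← Measure.integral_compProd (hFi' i)]
    congr 1
    have h2 := integral_map (μ := μ ⊗ₘ colourKernel d ρ i) hm.aemeasurable
      (f := F) hFm.aestronglyMeasurable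
    rw [← h2, map_compProd_recentre hρ hs hst i, integral_prod_symm _ (hFi i)]
    refine integral_congr_ae ?_
    filter_upwards [ae_palm_mem_sparseSet hρ hs i] with ζ hζ
    simp only [hF, sparseKernel_of_mem hζ]
    exact integral_mul_conj_weightedCount w (sparse_of_mem_sparseSet hρ hζ) (half_pos hρ)
      hf hg hBf hBg
  · intro i _
    have h : Integrable (fun q => F (q.2, recentre d m ρ q))
        ((Kernel.const Unit μ ⊗ₖ Kernel.prodMkLeft Unit (colourKernel d ρ i)) ()) := hFi' i
    exact (Integrable.integral_compProd h).const_mul _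

theorem fourier_compSubConstCLM_neg (g : 𝓢(Space d, ℂ)) (z y : Space d) :
    𝓕 (SchwartzMap.compSubConstCLM ℂ (-z) g) y =
      (Real.fourierChar (inner ℝ z y) : ℂ) * 𝓕 g y := by
  have h3 := congrFun (VectorFourier.fourierIntegral_comp_add_right Real.fourierChar
    (volume : Measure (Space d)) (innerₗ (Space d)) g z) y
  rw [SchwartzMap.fourier_coe, SchwartzMap.fourier_coe,
    show (⇑(SchwartzMap.compSubConstCLM ℂ (-z) g) : Space d → ℂ) = g ∘ fun v => v + z by
      ext v; simp]
  exact h3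

/-- The correlation of two Schwartz functions is a Fourier transform. -/
theorem integral_mul_conj_eq_fourier (f g h : 𝓢(Space d, ℂ))
    (hh : ∀ y, h y = 𝓕 f y * starRingEnd ℂ (𝓕 g y)) (z : Space d) :
    ∫ x, f x * starRingEnd ℂ (g (x + z)) = 𝓕 h z := by
  -- Parseval for `f` and `g (· + z)`. The translation becomes a factor `exp(2πi z·y)`, whose
  -- conjugate is the Fourier kernel at `z`.
  have h1 := SchwartzMap.integral_inner_fourier_fourier (SchwartzMap.compSubConstCLM ℂ (-z) g) f
  simp only [RCLike.inner_apply, SchwartzMap.compSubConstCLM_apply, sub_neg_eq_add] at h1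
  rw [← h1, SchwartzMap.fourier_coe h, Real.fourier_eq]
  refine integral_congr_ae (Eventually.of_forall fun y => ?_)
  simp only [fourier_compSubConstCLM_neg, hh, Circle.smul_def, smul_eq_mul, map_mul, AddChar.map_neg_eq_inv,
    Circle.coe_inv_eq_conj, real_inner_comm z y]
  ring

end SecondMoment

end ColouredPointProcess

namespace ColouredPointProcess

open scoped ContDiff NNReal CompactlySupported

/-! ### Smooth cutoffs and density of compactly supported functions. -/

section Cutoff

variable {d : ℕ}

/-- A smooth Urysohn function with compact support. -/
theorem exists_smooth_cutoff {s U : Set (Space d)} (hs : IsCompact s) (hU : IsOpen U)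
    (hsU : s ⊆ U) : ∃ χ : Space d → ℝ, ContDiff ℝ ∞ χ ∧ HasCompactSupport χ ∧
      (∀ᶠ x in 𝓝ˢ s, χ x = 1) ∧ (∀ x ∉ U, χ x = 0) ∧ ∀ x, 0 ≤ χ x ∧ χ x ≤ 1 := by
  obtain ⟨t, ht, hst, htU⟩ := exists_compact_between hs hU hsU
  obtain ⟨f, h1, h0, hf⟩ := exists_contMDiffMap_one_nhds_of_subset_interior (n := (⊤ : ℕ∞))
    (modelWithCornersSelf ℝ (Space d)) hs.isClosed hst
  refine ⟨f, f.contMDiff.contDiff, ?_, h1, fun x hx => h0 x fun hxt => hx (htU hxt), hf⟩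
  exact HasCompactSupport.intro ht h0

/-- A smooth compactly supported real function as a complex Schwartz function. -/
noncomputable def toComplexSchwartz (f : Space d → ℝ) (hf : ContDiff ℝ ∞ f)
    (hc : HasCompactSupport f) : 𝓢(Space d, ℂ) :=
  HasCompactSupport.toSchwartzMap (f := fun x => (f x : ℂ))
    (hc.comp_left (g := fun r : ℝ => (r : ℂ)) Complex.ofReal_zero)
    (Complex.ofRealCLM.contDiff.comp hf)

@[simp]
theorem toComplexSchwartz_apply (f : Space d → ℝ) (hf : ContDiff ℝ ∞ f)
    (hc : HasCompactSupport f) (x : Space d) : toComplexSchwartz f hf hc x = f x := rfl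

/-- Leibniz rule: a dilation with `|c| ≤ 1` contributes factors `|c| ^ i ≤ 1`, so the bound is
uniform in `c`. -/
theorem seminorm_smul_comp_le {χ : Space d → ℝ} (hχ : ContDiff ℝ ∞ χ) (hc : HasCompactSupport χ)
    (f : 𝓢(Space d, ℂ)) (k n : ℕ) : ∃ C, ∀ c : ℝ, |c| ≤ 1 → ∀ x,
      ‖x‖ ^ k * ‖iteratedFDeriv ℝ n (fun y => χ (c • y) • f y) x‖ ≤ C := by
  have hD : ∀ i : ℕ, ∃ D, ∀ x, ‖iteratedFDeriv ℝ i χ x‖ ≤ D := fun i =>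
    (hc.iteratedFDeriv i).exists_bound_of_continuous
      (hχ.continuous_iteratedFDeriv (mod_cast le_top))
  choose D hD using hD
  refine ⟨∑ i ∈ Finset.range (n + 1), (n.choose i : ℝ) * D i * SchwartzMap.seminorm ℝ k (n - i) f,
    fun c hc1 x => ?_⟩
  have hn : ((n : ℕ∞) : WithTop ℕ∞) ≤ (∞ : ℕ∞ω) := mod_cast le_top
  have hχc : ContDiff ℝ ∞ fun y => χ (c • y) := hχ.comp (contDiff_const_smul c)
  calc ‖x‖ ^ k * ‖iteratedFDeriv ℝ n (fun y => χ (c • y) • f y) x‖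
      ≤ ‖x‖ ^ k * ∑ i ∈ Finset.range (n + 1), (n.choose i : ℝ) *
          ‖iteratedFDeriv ℝ i (fun y => χ (c • y)) x‖ * ‖iteratedFDeriv ℝ (n - i) f x‖ := by
        gcongr
        exact norm_iteratedFDeriv_smul_le hχc (f.smooth ⊤) x hn
    _ = ∑ i ∈ Finset.range (n + 1), (n.choose i : ℝ) *
          ‖iteratedFDeriv ℝ i (fun y => χ (c • y)) x‖ *
            (‖x‖ ^ k * ‖iteratedFDeriv ℝ (n - i) f x‖) := by
        rw [Finset.mul_sum]
        exact Finset.sum_congr rfl fun i _ => by ring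
    _ ≤ _ := by
        refine Finset.sum_le_sum fun i _ => ?_
        have hi : ((i : ℕ∞) : WithTop ℕ∞) ≤ (∞ : ℕ∞ω) := mod_cast le_top
        have h1 : ‖iteratedFDeriv ℝ i (fun y => χ (c • y)) x‖ ≤ D i := by
          rw [iteratedFDeriv_comp_const_smul c (hχ.of_le hi), norm_smul, norm_pow,
            Real.norm_eq_abs]
          calc |c| ^ i * ‖iteratedFDeriv ℝ i χ (c • x)‖ ≤ 1 * D i :=
                mul_le_mul (pow_le_one₀ (abs_nonneg c) hc1) (hD i _) (norm_nonneg _) zero_le_one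
            _ = D i := one_mul _
        have h2 := SchwartzMap.le_seminorm ℝ k (n - i) f x
        have h3 : 0 ≤ D i := (norm_nonneg _).trans h1
        gcongr

theorem dense_hasCompactSupport : Dense {f : 𝓢(Space d, ℂ) | HasCompactSupport f} := by
  intro f
  obtain ⟨χ, hχ, hc, h1, -, hb⟩ := exists_smooth_cutoff (d := d) (isCompact_closedBall 0 1)
    isOpen_univ (Set.subset_univ _)
  have h1' : ∀ x : Space d, ‖x‖ ≤ 1 → ∀ᶠ y in 𝓝 x, χ y = 1 := fun x hx =>
    h1.filter_mono (nhds_le_nhdsSet (mem_closedBall_zero_iff.2 hx))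
  have hcn : ∀ N : ℕ, HasCompactSupport fun x => χ ((N + 1 : ℝ)⁻¹ • x) • f x := fun N =>
    (hc.comp_smul (c := (N + 1 : ℝ)⁻¹) (by positivity)).smul_right
  have hsn : ∀ N : ℕ, ContDiff ℝ ∞ fun x => χ ((N + 1 : ℝ)⁻¹ • x) • f x := fun N =>
    (hχ.comp (contDiff_const_smul _)).smul (f.smooth ⊤)
  refine mem_closure_of_tendsto (b := atTop)
    (f := fun N : ℕ => (hcn N).toSchwartzMap (hsn N)) ?_ (Eventually.of_forall hcn)
  rw [(schwartz_withSeminorms ℝ (Space d) ℂ).tendsto_nhds _ f]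
  rintro ⟨k, n⟩ ε hε
  -- One power of `‖x‖` more than the seminorm asks for: the difference vanishes near every point
  -- with `‖x‖ ≤ N + 1`, and beyond this the surplus factor gains `1 / (N + 1)`.
  obtain ⟨C, hC⟩ := seminorm_smul_comp_le hχ hc f (k + 1) n
  set C' := C + SchwartzMap.seminorm ℝ (k + 1) n f with hC'
  have hlim : Tendsto (fun N : ℕ => C' * (1 / ((N : ℝ) + 1))) atTop (𝓝 (C' * 0)) :=
    tendsto_one_div_add_atTop_nhds_zero_nat.const_mul C'
  rw [mul_zero] at hlim
  filter_upwards [hlim.eventually (gt_mem_nhds hε)] with N hN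
  refine (SchwartzMap.seminorm_le_bound ℝ k n _ (M := C' * (1 / ((N : ℝ) + 1))) ?_ ?_).trans_lt hN
  · have := (hC 0 (by simp) 0)
    have h0 : 0 ≤ C := (by positivity : (0 : ℝ) ≤ _).trans this
    positivity
  · intro x
    have hN0 : (0 : ℝ) < N + 1 := by positivity
    have hcoe : (⇑((hcn N).toSchwartzMap (hsn N) - f) : Space d → ℂ) =
        (fun y => χ ((N + 1 : ℝ)⁻¹ • y) • f y) - ⇑f := rfl
    rw [hcoe]
    rcases le_or_gt ‖x‖ (N + 1) with hx | hx
    · have hev : (fun y => χ ((N + 1 : ℝ)⁻¹ • y) • f y) - ⇑f =ᶠ[𝓝 x] fun _ => 0 := by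
        have hx' : ‖(N + 1 : ℝ)⁻¹ • x‖ ≤ 1 := by
          rw [norm_smul, norm_inv, Real.norm_of_nonneg hN0.le, inv_mul_le_iff₀ hN0, mul_one]
          exact hx
        have hcont : ContinuousAt (fun y : Space d => (N + 1 : ℝ)⁻¹ • y) x := by fun_prop
        filter_upwards [hcont.eventually (h1' _ hx')] with y hy
        simp only [Pi.sub_apply, hy, one_smul, sub_self]
      rw [(hev.iteratedFDeriv ℝ n).eq_of_nhds]
      have : iteratedFDeriv ℝ n (fun _ : Space d => (0 : ℂ)) x = 0 := by
        rw [iteratedFDeriv_fun_zero]; rfl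
      rw [this, norm_zero, mul_zero]
      have := (hC 0 (by simp) 0)
      have h0 : 0 ≤ C := (by positivity : (0 : ℝ) ≤ _).trans this
      positivity
    · have hn : ((n : ℕ∞) : WithTop ℕ∞) ≤ (∞ : ℕ∞ω) := mod_cast le_top
      rw [iteratedFDeriv_sub_apply ((hsn N).of_le hn).contDiffAt
        ((f.smooth ⊤).of_le hn).contDiffAt]
      rw [mul_one_div, le_div_iff₀ hN0]
      have hc1 : |((N : ℝ) + 1)⁻¹| ≤ 1 := by
        rw [abs_of_pos (by positivity)]
        exact inv_le_one_of_one_le₀ (by linarith [Nat.cast_nonneg (α := ℝ) N])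
      calc ‖x‖ ^ k * ‖iteratedFDeriv ℝ n (fun y => χ ((N + 1 : ℝ)⁻¹ • y) • f y) x -
              iteratedFDeriv ℝ n f x‖ * (N + 1)
          ≤ ‖x‖ ^ k * (‖iteratedFDeriv ℝ n (fun y => χ ((N + 1 : ℝ)⁻¹ • y) • f y) x‖ +
              ‖iteratedFDeriv ℝ n f x‖) * ‖x‖ := by
            gcongr
            exact norm_sub_le _ _
        _ = ‖x‖ ^ (k + 1) * ‖iteratedFDeriv ℝ n (fun y => χ ((N + 1 : ℝ)⁻¹ • y) • f y) x‖ +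
              ‖x‖ ^ (k + 1) * ‖iteratedFDeriv ℝ n f x‖ := by ring
        _ ≤ C' := add_le_add (hC _ hc1 x) (SchwartzMap.le_seminorm ℝ (k + 1) n f x)

end Cutoff

/-! ### Radon measures are determined by Schwartz functions. -/

section Uniqueness

variable {d : ℕ} {ν ν' : Measure (Space d)}

/-- By outer regularity it suffices to bound `ν s` by `ν' U` for open `U ⊇ s`; a smooth function
between the two indicators does this. -/
theorem measure_le_of_isCompact_of_smooth [IsLocallyFiniteMeasure ν] [IsLocallyFiniteMeasure ν']
    (h : ∀ f : 𝓢(Space d, ℂ), ∫ x, f x ∂ν = ∫ x, f x ∂ν') {s : Set (Space d)} (hs : IsCompact s) :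
    ν s ≤ ν' s := by
  rw [s.measure_eq_iInf_isOpen ν']
  refine le_iInf fun U => le_iInf fun hsU => le_iInf fun hU => ?_
  obtain ⟨χ, hχ, hc, h1, h0, hb⟩ := exists_smooth_cutoff hs hU hsU
  have hint : ∀ (P : Measure (Space d)) [IsLocallyFiniteMeasure P],
      ENNReal.ofReal (∫ x, χ x ∂P) = ∫⁻ x, ENNReal.ofReal (χ x) ∂P := fun P _ =>
    ofReal_integral_eq_lintegral_ofReal (hχ.continuous.integrable_of_hasCompactSupport hc)
      (Eventually.of_forall fun x => (hb x).1)
  have heq : ∫ x, χ x ∂ν = ∫ x, χ x ∂ν' := by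
    have := h (toComplexSchwartz χ hχ hc)
    simp only [toComplexSchwartz_apply, integral_complex_ofReal] at this
    exact_mod_cast this
  calc ν s = ∫⁻ x, s.indicator 1 x ∂ν := (lintegral_indicator_one hs.measurableSet).symm
    _ ≤ ∫⁻ x, ENNReal.ofReal (χ x) ∂ν := by
        refine lintegral_mono fun x => ?_
        by_cases hx : x ∈ s
        · simp [hx, h1.self_of_nhdsSet x hx]
        · simp [hx]
    _ = ∫⁻ x, ENNReal.ofReal (χ x) ∂ν' := by rw [← hint, ← hint, heq]
    _ ≤ ∫⁻ x, U.indicator 1 x ∂ν' := by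
        refine lintegral_mono fun x => ?_
        by_cases hx : x ∈ U
        · simp [hx, (hb x).2]
        · simp [hx, h0 x hx]
    _ = ν' U := lintegral_indicator_one hU.measurableSet

theorem ext_of_integral_schwartz [IsLocallyFiniteMeasure ν] [IsLocallyFiniteMeasure ν']
    (h : ∀ f : 𝓢(Space d, ℂ), ∫ x, f x ∂ν = ∫ x, f x ∂ν') : ν = ν' := by
  apply Measure.OuterRegular.ext_isOpen
  apply Measure.InnerRegularWRT.eq_of_innerRegularWRT_of_forall_eq Measure.Regular.innerRegular
    Measure.Regular.innerRegular
  intro s hs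
  exact le_antisymm (measure_le_of_isCompact_of_smooth h hs)
    (measure_le_of_isCompact_of_smooth (fun f => (h f).symm) hs)

end Uniqueness

/-! ### Riesz–Markov for functionals on smooth functions. -/

section Representation

variable {d : ℕ}

/-- A linear functional on Schwartz functions that is nonnegative on the squares `|φ|²`. -/
def IsNonnegOnSquares (L : 𝓢(Space d, ℂ) →ₗ[ℂ] ℂ) : Prop :=
  ∀ φ h : 𝓢(Space d, ℂ), (∀ x, h x = φ x * starRingEnd ℂ (φ x)) → 0 ≤ (L h).re ∧ (L h).im = 0

variable {L : 𝓢(Space d, ℂ) →ₗ[ℂ] ℂ}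

/-- A nonnegative smooth function need not have a smooth square root. With `χ = 1` on the support of
`f`, however, `f + ε χ² = (χ √(f + ε))²` is the square of a smooth function, and `ε` tends to `0`.
-/
theorem IsNonnegOnSquares.nonneg (hL : IsNonnegOnSquares L) {f : Space d → ℝ}
    (hf : ContDiff ℝ ∞ f) (hc : HasCompactSupport f) (h0 : ∀ x, 0 ≤ f x) :
    0 ≤ (L (toComplexSchwartz f hf hc)).re := by
  obtain ⟨χ, hχ, hχc, h1, -, hb⟩ := exists_smooth_cutoff hc.isCompact isOpen_univ
    (Set.subset_univ (tsupport f))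
  have hχf : ∀ x, χ x * χ x * f x = f x := fun x => by
    by_cases hx : x ∈ tsupport f
    · rw [h1.self_of_nhdsSet x hx]; ring
    · rw [image_eq_zero_of_notMem_tsupport hx, mul_zero]
  set S := toComplexSchwartz χ hχ hχc
  have hχ2 : ContDiff ℝ ∞ fun x => χ x * χ x := hχ.mul hχ
  set X := toComplexSchwartz (fun x => χ x * χ x) hχ2 hχc.mul_left
  have key : ∀ ε : ℝ, 0 < ε → 0 ≤ (L (toComplexSchwartz f hf hc)).re + ε * (L X).re := by
    intro ε hε
    have hpos : ∀ x, 0 < f x + ε := fun x => by linarith [h0 x]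
    have hsq : ContDiff ℝ ∞ fun x => χ x * √(f x + ε) :=
      hχ.mul ((hf.add contDiff_const).sqrt fun x => (hpos x).ne')
    have h2 := (hL (toComplexSchwartz _ hsq hχc.mul_right)
      (toComplexSchwartz f hf hc + (ε : ℂ) • X) fun x => ?_).1
    · rw [map_add, map_smul, Complex.add_re, smul_eq_mul, Complex.re_ofReal_mul] at h2
      exact h2
    · change (f x : ℂ) + ε * ((χ x * χ x : ℝ) : ℂ) = ((χ x * √(f x + ε) : ℝ) : ℂ) *
        starRingEnd ℂ ((χ x * √(f x + ε) : ℝ) : ℂ)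
      rw [Complex.conj_ofReal]
      norm_cast
      have := Real.mul_self_sqrt (hpos x).le
      calc f x + ε * (χ x * χ x) = χ x * χ x * f x + ε * (χ x * χ x) := by rw [hχf]
        _ = χ x * χ x * (√(f x + ε) * √(f x + ε)) := by rw [this]; ring
        _ = _ := by ring
  refine le_of_forall_pos_le_add fun δ hδ => ?_
  have hlt : 0 < |(L X).re| + 1 := by positivity
  have := key (δ / (|(L X).re| + 1)) (by positivity)
  have h3 : δ / (|(L X).re| + 1) * (L X).re ≤ δ := by
    rw [div_mul_eq_mul_div, div_le_iff₀ hlt]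
    nlinarith [le_abs_self (L X).re]
  linarith

/-- Polarisation with a cutoff `χ` equal to `1` on the support of `f`: `4 f = (f + χ)² - (f - χ)²`.
-/
theorem IsNonnegOnSquares.im_eq_zero (hL : IsNonnegOnSquares L) {f : Space d → ℝ}
    (hf : ContDiff ℝ ∞ f) (hc : HasCompactSupport f) :
    (L (toComplexSchwartz f hf hc)).im = 0 := by
  obtain ⟨χ, hχ, hχc, h1, -, hb⟩ := exists_smooth_cutoff hc.isCompact isOpen_univ
    (Set.subset_univ (tsupport f))
  have hχf : ∀ x, χ x * f x = f x := fun x => by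
    by_cases hx : x ∈ tsupport f
    · rw [h1.self_of_nhdsSet x hx]; ring
    · rw [image_eq_zero_of_notMem_tsupport hx, mul_zero]
  have hp : ContDiff ℝ ∞ fun x => (f x + χ x) * (f x + χ x) := (hf.add hχ).mul (hf.add hχ)
  have hm : ContDiff ℝ ∞ fun x => (f x - χ x) * (f x - χ x) := (hf.sub hχ).mul (hf.sub hχ)
  set P := toComplexSchwartz _ hp (hc.add hχc).mul_left
  set M := toComplexSchwartz _ hm (hc.sub hχc).mul_left
  have h1 := (hL (toComplexSchwartz _ (hf.add hχ) (hc.add hχc)) P fun x => by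
    simp [P]).2
  have h2 := (hL (toComplexSchwartz _ (hf.sub hχ) (hc.sub hχc)) M fun x => by
    simp [M]).2
  have h3 : toComplexSchwartz f hf hc = ((4⁻¹ : ℝ) : ℂ) • (P - M) := by
    ext x
    change (f x : ℂ) = ((4⁻¹ : ℝ) : ℂ) * (((f x + χ x) * (f x + χ x) : ℝ) -
      ((f x - χ x) * (f x - χ x) : ℝ))
    norm_cast
    linarith [hχf x]
  rw [h3, map_smul, smul_eq_mul, Complex.im_ofReal_mul, map_sub, Complex.sub_im, h1, h2]
  simp

/-- The smooth functions in `C_c(ℝ^d, ℝ)`. -/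
def smoothSubmodule (d : ℕ) : Submodule ℝ C_c(Space d, ℝ) where
  carrier := {f | ContDiff ℝ ∞ f}
  add_mem' {f g} (hf : ContDiff ℝ ∞ f) (hg : ContDiff ℝ ∞ g) :=
    show ContDiff ℝ ∞ ⇑(f + g) from hf.add hg
  zero_mem' := show ContDiff ℝ ∞ ⇑(0 : C_c(Space d, ℝ)) from contDiff_const
  smul_mem' c f (hf : ContDiff ℝ ∞ f) := show ContDiff ℝ ∞ ⇑(c • f) from contDiff_const.smul hf

/-- The Riesz–Markov theorem for functionals that are defined on smooth functions only. -/
theorem IsNonnegOnSquares.exists_measure (hL : IsNonnegOnSquares L) :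
    ∃ ν : Measure (Space d), IsLocallyFiniteMeasure ν ∧
      ∀ f : 𝓢(Space d, ℂ), HasCompactSupport f → ∫ x, f x ∂ν = L f := by
  let Λ₀ : C_c(Space d, ℝ) →ₗ.[ℝ] ℝ :=
    { domain := smoothSubmodule d
      toFun :=
        { toFun := fun f => (L (toComplexSchwartz f f.2 f.1.hasCompactSupport)).re
          map_add' := fun f g => by
            rw [← Complex.add_re, ← map_add]
            congr 2
            ext x
            exact Complex.ofReal_add _ _
          map_smul' := fun c f => by
            rw [RingHom.id_apply, smul_eq_mul, ← Complex.re_ofReal_mul, ← smul_eq_mul, ← map_smul]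
            congr 2
            ext x
            exact Complex.ofReal_mul _ _ } }
  let s : PointedCone ℝ C_c(Space d, ℝ) :=
    { carrier := {f | ∀ x, 0 ≤ f x}
      add_mem' := fun hf hg x => add_nonneg (hf x) (hg x)
      zero_mem' := fun _ => le_rfl
      smul_mem' := fun c f hf x => mul_nonneg c.2 (hf x) }
  -- M. Riesz extension from smooth functions to all of `C_c`: every `f` satisfies `-f ≤ C χ` for a
  -- smooth cutoff `χ`, so the extension stays positive and Riesz–Markov applies.
  obtain ⟨g, hg1, hg2⟩ := riesz_extension s Λ₀
    (fun f hf => hL.nonneg f.2 f.1.hasCompactSupport hf) (fun f => by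
      obtain ⟨χ, hχ, hχc, h1, -, hb⟩ := exists_smooth_cutoff f.hasCompactSupport.isCompact
        isOpen_univ (Set.subset_univ (tsupport f))
      obtain ⟨C, hC⟩ := f.hasCompactSupport.exists_bound_of_continuous f.continuous
      refine ⟨⟨⟨⟨fun x => C * χ x, (contDiff_const.mul hχ).continuous⟩, hχc.mul_left⟩,
        contDiff_const.mul hχ⟩, fun x => ?_⟩
      change 0 ≤ C * χ x + f x
      by_cases hx : x ∈ tsupport f
      · rw [h1.self_of_nhdsSet x hx]
        have := (abs_le.1 (hC x)).1
        linarith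
      · rw [image_eq_zero_of_notMem_tsupport hx, add_zero]
        exact mul_nonneg ((norm_nonneg _).trans (hC x)) (hb x).1)
  let Λ : C_c(Space d, ℝ) →ₚ[ℝ] ℝ := PositiveLinearMap.mk₀ g fun f hf => hg2 f hf
  have hreal : ∀ (f : Space d → ℝ) (hf : ContDiff ℝ ∞ f) (hc : HasCompactSupport f),
      ((∫ x, f x ∂(RealRMK.rieszMeasure Λ) : ℝ) : ℂ) = L (toComplexSchwartz f hf hc) := by
    intro f hf hc
    have h1 := RealRMK.integral_rieszMeasure Λ ⟨⟨f, hf.continuous⟩, hc⟩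
    have h2 : Λ ⟨⟨f, hf.continuous⟩, hc⟩ = (L (toComplexSchwartz f hf hc)).re :=
      hg1 ⟨⟨⟨f, hf.continuous⟩, hc⟩, hf⟩
    rw [h2] at h1
    apply Complex.ext
    · rw [Complex.ofReal_re]; exact h1
    · rw [Complex.ofReal_im, hL.im_eq_zero]
  refine ⟨RealRMK.rieszMeasure Λ, inferInstance, fun f hc => ?_⟩
  have hre : ContDiff ℝ ∞ fun x => (f x).re := Complex.reCLM.contDiff.comp (f.smooth ⊤)
  have him : ContDiff ℝ ∞ fun x => (f x).im := Complex.imCLM.contDiff.comp (f.smooth ⊤)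
  have hcre : HasCompactSupport fun x => (f x).re := hc.comp_left Complex.zero_re
  have hcim : HasCompactSupport fun x => (f x).im := hc.comp_left Complex.zero_im
  have hf : f = toComplexSchwartz _ hre hcre + Complex.I • toComplexSchwartz _ him hcim := by
    ext x
    change f x = ((f x).re : ℂ) + Complex.I * ((f x).im : ℂ)
    rw [mul_comm, Complex.re_add_im]
  have hint := integral_re_add_im (𝕜 := ℂ)
    (f.continuous.integrable_of_hasCompactSupport (μ := RealRMK.rieszMeasure Λ) hc)
  conv_rhs => rw [hf, map_add, map_smul, ← hreal, ← hreal, smul_eq_mul]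
  rw [← hint, mul_comm Complex.I]
  rfl

end Representation

end ColouredPointProcess

namespace ColouredPointProcess

open ProbabilityTheory

/-! ### The first moment as a distribution, and its Fourier transform. -/

section Functional

variable {d m : ℕ} {ρ B : ℝ} {μ : Measure (Measure (ColouredSpace d m))} (w : Fin m → ℝ)

/-- A bound for the weighted first moment of functions that are dominated by `weight`. -/
noncomputable def momentBound (μ : Measure (Measure (ColouredSpace d m))) (w : Fin m → ℝ)
    (ρ : ℝ) : ℝ :=
  ∑ i, |w i| * (((∑ j, |w j|) * (weightBound d (ρ / 2) 1).toReal) * (palm μ i).real Set.univ)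

theorem momentBound_nonneg : 0 ≤ momentBound μ w ρ :=
  Finset.sum_nonneg fun i _ => by positivity

theorem norm_weightedFirstMoment_le [IsProbabilityMeasure μ] (hρ : 0 < ρ)
    (hs : ∀ᵐ η ∂μ, Sparse ρ η) {f : Space d → ℂ} (hB : ∀ x, ‖f x‖ ≤ B * weight x) :
    ‖weightedFirstMoment μ w f‖ ≤ momentBound μ w ρ * B := by
  have hfin := isFiniteMeasure_palm (μ := μ) hρ hs
  rw [weightedFirstMoment, weightedPalmIntegral, momentBound, Finset.sum_mul]
  refine norm_sum_le_of_le _ fun i _ => ?_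
  rw [norm_mul, Complex.norm_real, Real.norm_eq_abs, mul_assoc]
  gcongr
  have h : ∀ᵐ ζ ∂(palm μ i), ‖weightedCount w f ζ‖ ≤
      (∑ j, |w j|) * (B * (weightBound d (ρ / 2) 1).toReal) := by
    filter_upwards [ae_palm_mem_sparseSet hρ hs i] with ζ hζ
    exact norm_weightedCount_le w (sparse_of_mem_sparseSet hρ hζ) (half_pos hρ) (b := 0)
      (by simpa using hB)
  refine (norm_integral_le_of_norm_le_const h).trans (le_of_eq ?_)
  ring

theorem weightedFirstMoment_add [IsProbabilityMeasure μ] (hρ : 0 < ρ)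
    (hs : ∀ᵐ η ∂μ, Sparse ρ η) (f g : 𝓢(Space d, ℂ)) :
    weightedFirstMoment μ w (fun x => f x + g x) =
      weightedFirstMoment μ w f + weightedFirstMoment μ w g := by
  have hfin := isFiniteMeasure_palm (μ := μ) hρ hs
  have hi : ∀ (h : 𝓢(Space d, ℂ)) i, Integrable (weightedCount w h) (palm μ i) := fun h i => by
    obtain ⟨B, hB⟩ := exists_norm_le_weight h
    exact (memLp_top_weightedCount w (ae_palm_mem_sparseSet hρ hs i) hρ h.continuous.measurable
      (b := 0) (by simpa using hB)).integrable le_top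
  unfold weightedFirstMoment weightedPalmIntegral
  rw [← Finset.sum_add_distrib]
  refine Finset.sum_congr rfl fun i _ => ?_
  rw [← mul_add, ← integral_add (hi f i) (hi g i)]
  congr 1
  refine integral_congr_ae ?_
  filter_upwards [ae_palm_mem_sparseSet hρ hs i] with ζ hζ
  exact weightedCount_add w (sparse_of_mem_sparseSet hρ hζ) (half_pos hρ) f g

theorem weightedFirstMoment_const_mul (c : ℂ) (f : Space d → ℂ) :
    weightedFirstMoment μ w (fun x => c * f x) = c * weightedFirstMoment μ w f := by
  unfold weightedFirstMoment weightedPalmIntegral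
  rw [Finset.mul_sum]
  refine Finset.sum_congr rfl fun i _ => ?_
  simp_rw [weightedCount_const_mul]
  rw [integral_const_mul]
  ring

theorem weightedFirstMoment_conj (f : Space d → ℂ) :
    weightedFirstMoment μ w (fun x => starRingEnd ℂ (f x)) =
      starRingEnd ℂ (weightedFirstMoment μ w f) := by
  unfold weightedFirstMoment weightedPalmIntegral
  rw [map_sum]
  refine Finset.sum_congr rfl fun i _ => ?_
  simp_rw [weightedCount_conj]
  rw [integral_conj, map_mul, Complex.conj_ofReal]

/-- The weighted first moment as a tempered distribution. -/
noncomputable def momentCLM [IsProbabilityMeasure μ] (hρ : 0 < ρ)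
    (hs : ∀ᵐ η ∂μ, Sparse ρ η) : 𝓢(Space d, ℂ) →L[ℂ] ℂ :=
  SchwartzMap.mkCLMtoNormedSpace (σ := RingHom.id ℂ) (fun f => weightedFirstMoment μ w f)
    (fun f g => weightedFirstMoment_add w hρ hs f g)
    (fun c f => weightedFirstMoment_const_mul w c f)
    ⟨Finset.Iic (d + 1, 0), momentBound μ w ρ * 2 ^ (d + 1),
      mul_nonneg (momentBound_nonneg w) (by positivity), fun f =>
        (norm_weightedFirstMoment_le w hρ hs (norm_le_seminorm_mul_weight f)).trans_eq
          (mul_assoc _ _ _).symm⟩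

theorem weightedFirstMoment_fourier_mul_conj [IsProbabilityMeasure μ] (hρ : 0 < ρ)
    (hs : ∀ᵐ η ∂μ, Sparse ρ η) (hst : ∀ t, μ.map (translate t) = μ) (f g h : 𝓢(Space d, ℂ))
    (hh : ∀ y, h y = 𝓕 f y * starRingEnd ℂ (𝓕 g y)) :
    weightedFirstMoment μ w (𝓕 h : 𝓢(Space d, ℂ)) =
      ∫ η, weightedCount w f η * starRingEnd ℂ (weightedCount w g η) ∂μ := by
  obtain ⟨Bf, hBf⟩ := exists_norm_le_weight f
  obtain ⟨Bg, hBg⟩ := exists_norm_le_weight g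
  rw [integral_weightedCount_mul_conj w hρ hs hst f.continuous g.continuous hBf hBg]
  congr 1
  ext z
  exact (integral_mul_conj_eq_fourier f g h hh z).symm

/-- With `ψ = 𝓕⁻ φ`, the value at `|φ|²` is the second moment `∫ |N^w_ψ|² dμ`. -/
theorem isNonnegOnSquares_moment [IsProbabilityMeasure μ] (hρ : 0 < ρ)
    (hs : ∀ᵐ η ∂μ, Sparse ρ η) (hst : ∀ t, μ.map (translate t) = μ) :
    IsNonnegOnSquares ((momentCLM w hρ hs).toLinearMap ∘ₗ
      FourierTransform.fourierₗ ℂ 𝓢(Space d, ℂ)) := by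
  intro φ h hh
  have h1 := weightedFirstMoment_fourier_mul_conj w hρ hs hst (𝓕⁻ φ) (𝓕⁻ φ) h
    (by simpa using hh)
  have h2 : ∫ η, weightedCount w (𝓕⁻ φ : 𝓢(Space d, ℂ)) η *
      starRingEnd ℂ (weightedCount w (𝓕⁻ φ : 𝓢(Space d, ℂ)) η) ∂μ =
      ((∫ η, ‖weightedCount w (𝓕⁻ φ : 𝓢(Space d, ℂ)) η‖ ^ 2 ∂μ : ℝ) : ℂ) := by
    rw [← integral_complex_ofReal]
    refine integral_congr_ae (Eventually.of_forall fun η => ?_)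
    simp only [Complex.mul_conj']
    norm_cast
  change 0 ≤ (weightedFirstMoment μ w (𝓕 h : 𝓢(Space d, ℂ))).re ∧
    (weightedFirstMoment μ w (𝓕 h : 𝓢(Space d, ℂ))).im = 0
  rw [h1, h2]
  exact ⟨integral_nonneg fun _ => sq_nonneg _, Complex.ofReal_im _⟩

/-- Translating a cutoff multiplies its Fourier transform by a unimodular factor, so the decay bound
for the moment is the same for every centre `a`. -/
theorem exists_translationBounded [IsProbabilityMeasure μ] (hρ : 0 < ρ)
    (hs : ∀ᵐ η ∂μ, Sparse ρ η) {ν : Measure (Space d)} [IsLocallyFiniteMeasure ν]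
    (hν : ∀ f : 𝓢(Space d, ℂ), HasCompactSupport f →
      ∫ x, f x ∂ν = weightedFirstMoment μ w (𝓕 f : 𝓢(Space d, ℂ))) :
    ∃ K, K ≠ ∞ ∧ TranslationBounded 1 K ν := by
  obtain ⟨χ, hχ, hc, h1, -, hb⟩ := exists_smooth_cutoff (d := d) (isCompact_closedBall 0 1)
    isOpen_univ (Set.subset_univ _)
  obtain ⟨B, hB⟩ := exists_norm_le_weight (𝓕 (toComplexSchwartz χ hχ hc))
  refine ⟨ENNReal.ofReal (momentBound μ w ρ * B), ENNReal.ofReal_ne_top, fun a => ?_⟩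
  -- The double negation matches `fourier_compSubConstCLM_neg` with `z = -a`.
  set f := SchwartzMap.compSubConstCLM ℂ (- -a) (toComplexSchwartz χ hχ hc) with hf
  have hcχ : HasCompactSupport fun x => χ (x - a) :=
    hc.comp_homeomorph (Homeomorph.subRight a)
  have hcf : HasCompactSupport f := by
    have : HasCompactSupport fun x => ((χ (x - a) : ℝ) : ℂ) :=
      hcχ.comp_left (g := fun r : ℝ => (r : ℂ)) Complex.ofReal_zero
    convert this using 1
    ext x
    simp [hf]
  have hint : ∫ x, f x ∂ν = ((∫ x, χ (x - a) ∂ν : ℝ) : ℂ) := by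
    rw [← integral_complex_ofReal]
    refine integral_congr_ae (Eventually.of_forall fun x => ?_)
    simp [hf]
  have hnorm : ∫ x, χ (x - a) ∂ν ≤ momentBound μ w ρ * B := by
    have h2 := norm_weightedFirstMoment_le w hρ hs (f := (𝓕 f : 𝓢(Space d, ℂ))) (B := B)
      fun y => by
        rw [hf, fourier_compSubConstCLM_neg, norm_mul, Circle.norm_coe, one_mul]
        exact hB y
    rw [← hν f hcf, hint, Complex.norm_real] at h2
    exact (le_abs_self _).trans h2
  have hχi : Integrable (fun x => χ (x - a)) ν :=
    (hχ.continuous.comp (by fun_prop)).integrable_of_hasCompactSupport hcχ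
  calc ν (Metric.ball a 1) = ∫⁻ x, (Metric.ball a 1).indicator 1 x ∂ν :=
        (lintegral_indicator_one Metric.isOpen_ball.measurableSet).symm
    _ ≤ ∫⁻ x, ENNReal.ofReal (χ (x - a)) ∂ν := by
        refine lintegral_mono fun x => ?_
        by_cases hx : x ∈ Metric.ball a 1
        · have : χ (x - a) = 1 := h1.self_of_nhdsSet _ (by
            rw [mem_closedBall_zero_iff, ← dist_eq_norm]
            exact (Metric.mem_ball.1 hx).le)
          simp [hx, this]
        · simp [hx]
    _ = ENNReal.ofReal (∫ x, χ (x - a) ∂ν) :=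
        (ofReal_integral_eq_lintegral_ofReal hχi (Eventually.of_forall fun x => (hb _).1)).symm
    _ ≤ _ := ENNReal.ofReal_le_ofReal hnorm

/-- Translation boundedness makes `ν` temperate. Both sides are then continuous on Schwartz space
and agree on the dense set of compactly supported functions. -/
theorem exists_isFourierTransform [IsProbabilityMeasure μ] (hρ : 0 < ρ)
    (hs : ∀ᵐ η ∂μ, Sparse ρ η) (hst : ∀ t, μ.map (translate t) = μ) :
    ∃ ν, IsFourierTransform (weightedFirstMoment μ w) ν := by
  obtain ⟨ν, hloc, hν⟩ := (isNonnegOnSquares_moment w hρ hs hst).exists_measure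
  obtain ⟨K, hK, hb⟩ := exists_translationBounded w hρ hs hν
  have := hb.hasTemperateGrowth one_pos hK
  refine ⟨ν, hloc, fun f => f.integrable, fun f => ?_⟩
  have h := Continuous.ext_on dense_hasCompactSupport
    (SchwartzMap.integralCLM ℂ ν (D := Space d) (V := ℂ)).continuous
    ((momentCLM w hρ hs).comp (FourierTransform.fourierCLM ℂ 𝓢(Space d, ℂ))).continuous
    fun f hf => hν f hf
  exact congrFun h f

theorem IsFourierTransform.translationBounded [IsProbabilityMeasure μ] (hρ : 0 < ρ)
    (hs : ∀ᵐ η ∂μ, Sparse ρ η) {ν : Measure (Space d)}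
    (hν : IsFourierTransform (weightedFirstMoment μ w) ν) :
    ∃ K, K ≠ ∞ ∧ TranslationBounded 1 K ν :=
  have := hν.isLocallyFinite
  exists_translationBounded w hρ hs fun f _ => hν.integral_eq f

theorem IsFourierTransform.unique {ω : (Space d → ℂ) → ℂ} {ν ν' : Measure (Space d)}
    (hν : IsFourierTransform ω ν) (hν' : IsFourierTransform ω ν') : ν' = ν := by
  have := hν.isLocallyFinite
  have := hν'.isLocallyFinite
  exact ext_of_integral_schwartz fun f => by rw [hν.integral_eq, hν'.integral_eq]

end Functional

/-! ### The isometric embedding of `L²(ν)`. -/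

section Embedding

variable {d m : ℕ} {ρ : ℝ} {μ : Measure (Measure (ColouredSpace d m))} (w : Fin m → ℝ)
  {ν : Measure (Space d)}

theorem norm_toLp_sq {α : Type*} [MeasurableSpace α] {P : Measure α} {u : α → ℂ}
    (hu : MemLp u 2 P) : (‖hu.toLp u‖ : ℂ) ^ 2 = ∫ x, u x * starRingEnd ℂ (u x) ∂P := by
  have h := inner_self_eq_norm_sq_to_K (𝕜 := ℂ) (hu.toLp u)
  rw [L2.inner_def] at h
  refine h.symm.trans (integral_congr_ae ?_)
  filter_upwards [hu.coeFn_toLp] with x hx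
  rw [hx, RCLike.inner_apply]

theorem memLp_weightedCount [IsProbabilityMeasure μ] (hρ : 0 < ρ) (hs : ∀ᵐ η ∂μ, Sparse ρ η)
    (f : 𝓢(Space d, ℂ)) : MemLp (weightedCount w f) 2 μ := by
  obtain ⟨B, hB⟩ := exists_norm_le_weight f
  exact (memLp_top_weightedCount w (hs.mono fun η hη => hη.mem_sparseSet) hρ
    f.continuous.measurable (b := 0) (by simpa using hB)).mono_exponent le_top

/-- The map `f ↦ N^w_f` from Schwartz functions to `L²(μ)`. -/
noncomputable def countₗ [IsProbabilityMeasure μ] (hρ : 0 < ρ) (hs : ∀ᵐ η ∂μ, Sparse ρ η) :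
    𝓢(Space d, ℂ) →ₗ[ℂ] Lp ℂ 2 μ where
  toFun f := (memLp_weightedCount w hρ hs f).toLp _
  map_add' f g := by
    rw [← MemLp.toLp_add]
    apply MemLp.toLp_congr
    filter_upwards [hs] with η hη
    exact weightedCount_add w hη hρ f g
  map_smul' c f := by
    rw [RingHom.id_apply, ← MemLp.toLp_const_smul]
    apply MemLp.toLp_congr
    exact Eventually.of_forall fun η => weightedCount_const_mul w η c f

theorem denseRange_fourier_toLp [ν.HasTemperateGrowth] [IsLocallyFiniteMeasure ν] :
    DenseRange ((SchwartzMap.toLpCLM ℂ ℂ 2 ν).toLinearMap ∘ₗ FourierTransform.fourierₗ ℂ 𝓢(Space d, ℂ)) := by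
  have h : DenseRange (SchwartzMap.toLpCLM ℝ ℂ 2 ν : 𝓢(Space d, ℂ) → Lp ℂ 2 ν) :=
    SchwartzMap.denseRange_toLpCLM (by norm_num)
  have hsurj : Function.Surjective (FourierTransform.fourierₗ ℂ 𝓢(Space d, ℂ)) := fun f =>
    ⟨𝓕⁻ f, by simp⟩
  rw [DenseRange, LinearMap.coe_comp, hsurj.range_comp]
  exact h

theorem isDiffractionEmbedding_iff [IsProbabilityMeasure μ] (hρ : 0 < ρ)
    (hs : ∀ᵐ η ∂μ, Sparse ρ η) [ν.HasTemperateGrowth] (θ : Lp ℂ 2 ν →ₗᵢ[ℂ] Lp ℂ 2 μ) :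
    IsDiffractionEmbedding μ w ν θ ↔
      ∀ f : 𝓢(Space d, ℂ), θ ((𝓕 f : 𝓢(Space d, ℂ)).toLp 2 ν) = countₗ w hρ hs f := by
  refine forall_congr' fun f => ⟨fun ⟨hf, h⟩ => ?_, fun h => ⟨(𝓕 f).memLp 2 ν, ?_⟩⟩
  · refine Lp.ext (h.trans ?_)
    exact (memLp_weightedCount w hρ hs f).coeFn_toLp.symm
  · change θ ((𝓕 f : 𝓢(Space d, ℂ)).toLp 2 ν) =ᵐ[μ] _
    rw [h]
    exact (memLp_weightedCount w hρ hs f).coeFn_toLp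

/-- The diagonal case of the second moment identity, with `|f̂|²` as the Schwartz function. -/
theorem IsFourierTransform.norm_countₗ [IsProbabilityMeasure μ] (hρ : 0 < ρ)
    (hs : ∀ᵐ η ∂μ, Sparse ρ η) (hst : ∀ t, μ.map (translate t) = μ)
    (hν : IsFourierTransform (weightedFirstMoment μ w) ν) [ν.HasTemperateGrowth]
    (f : 𝓢(Space d, ℂ)) :
    ‖countₗ w hρ hs f‖ = ‖(𝓕 f : 𝓢(Space d, ℂ)).toLp 2 ν‖ := by
  have h1 := norm_toLp_sq (memLp_weightedCount w hρ hs f)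
  have h2 := norm_toLp_sq ((𝓕 f : 𝓢(Space d, ℂ)).memLp 2 ν)
  set h : 𝓢(Space d, ℂ) := SchwartzMap.pairing (ContinuousLinearMap.mul ℂ ℂ) (𝓕 f)
    (SchwartzMap.postcompCLM (𝕜 := ℝ) Complex.conjCLE.toContinuousLinearMap (𝓕 f)) with hh
  have h3 : ∀ y, h y = 𝓕 f y * starRingEnd ℂ (𝓕 f y) := fun y => by simp [hh]
  have h4 := weightedFirstMoment_fourier_mul_conj w hρ hs hst f f h h3
  rw [← h1, ← hν.integral_eq h] at h4
  simp_rw [h3] at h4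
  rw [← h2] at h4
  have h5 : ‖countₗ w hρ hs f‖ ^ 2 = ‖(𝓕 f : 𝓢(Space d, ℂ)).toLp 2 ν‖ ^ 2 := by
    exact_mod_cast h4.symm
  exact (pow_left_inj₀ (norm_nonneg _) (norm_nonneg _) two_ne_zero).1 h5

theorem IsFourierTransform.existsUnique_embedding [IsProbabilityMeasure μ] (hρ : 0 < ρ)
    (hs : ∀ᵐ η ∂μ, Sparse ρ η) (hst : ∀ t, μ.map (translate t) = μ)
    (hν : IsFourierTransform (weightedFirstMoment μ w) ν) :
    ∃ θ : Lp ℂ 2 ν →ₗᵢ[ℂ] Lp ℂ 2 μ, IsDiffractionEmbedding μ w ν θ ∧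
      ∀ θ' : Lp ℂ 2 ν →ₗᵢ[ℂ] Lp ℂ 2 μ, IsDiffractionEmbedding μ w ν θ' → θ' = θ := by
  obtain ⟨K, hK, hb⟩ := hν.translationBounded w hρ hs
  have := hb.hasTemperateGrowth one_pos hK
  have := hν.isLocallyFinite
  have hd := denseRange_fourier_toLp (ν := ν)
  set e := (SchwartzMap.toLpCLM ℂ ℂ 2 ν).toLinearMap ∘ₗ FourierTransform.fourierₗ ℂ 𝓢(Space d, ℂ) with he
  have hn : ∀ f, ‖countₗ w hρ hs f‖ = ‖e f‖ := hν.norm_countₗ w hρ hs hst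
  have hle : ∃ C, ∀ f, ‖countₗ w hρ hs f‖ ≤ C * ‖e f‖ := ⟨1, fun f => by rw [hn, one_mul]⟩
  -- The map `e` need not be injective; equality of norms makes `e f ↦ countₗ f` well defined on its
  -- dense range.
  set Θ := (countₗ w hρ hs).extendOfNorm e with hΘ
  have hΘe : ∀ f, Θ (e f) = countₗ w hρ hs f := LinearMap.extendOfNorm_eq hd hle
  have hΘn : ∀ u, ‖Θ u‖ = ‖u‖ := fun u =>
    hd.induction (P := fun u => ‖Θ u‖ = ‖u‖)
      (by rintro _ ⟨f, rfl⟩; rw [hΘe, hn]) (isClosed_eq (by fun_prop) (by fun_prop)) u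
  refine ⟨⟨Θ.toLinearMap, hΘn⟩, (isDiffractionEmbedding_iff w hρ hs _).2 hΘe, fun θ' h' => ?_⟩
  rw [isDiffractionEmbedding_iff w hρ hs] at h'
  have : (θ' : Lp ℂ 2 ν → Lp ℂ 2 μ) = Θ :=
    hd.equalizer θ'.continuous Θ.continuous (funext fun f => (h' f).trans (hΘe f).symm)
  ext1 u
  exact congrFun this u

end Embedding

end ColouredPointProcess

namespace ColouredPointProcess

open ProbabilityTheory
open scoped ContDiff

/-! ### The averages as weighted counts, and their smooth versions. -/

section Average

variable {d m : ℕ} {ρ : ℝ} (w : Fin m → ℝ) (k : Space d)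

/-- The function on `ℝ^d` whose weighted count is the average over `C_R`. -/
noncomputable def averageFun (k : Space d) (R : ℝ) : Space d → ℂ :=
  (cube d R).indicator fun x => (((R ^ d)⁻¹ : ℝ) : ℂ) * character k x

/-- Each point in the cube contributes `1` to a finite total mass, so there are finitely many. This
turns the `tsum` in `average` into a finite sum. -/
theorem exists_finset_of_mem_pointMeasures {r R : ℝ} (hr : 0 < r) (hR : 0 ≤ R)
    {η : Measure (ColouredSpace d m)} (hη : η ∈ pointMeasures d m r) :
    ∃ F : Finset (Space d), (F : Set (Space d)) ⊆ cube d R ∧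
      η (Prod.fst ⁻¹' (cube d R \ F)) = 0 := by
  classical
  have hsp := Sparse.of_mem_pointMeasures hη
  have hlt : η (Prod.fst ⁻¹' cube d R) < ⊤ := by
    refine (measure_mono (Set.preimage_mono (t := Metric.ball 0 (d * R + 1)) fun x hx => ?_)).trans_lt
      ((Measure.map_apply measurable_fst Metric.isOpen_ball.measurableSet).symm.trans_le
        (hsp.map_fst.measure_ball_le (half_pos hr) ENNReal.one_ne_top (d * R + 1)) |>.trans_lt ?_)
    · rw [mem_ball_zero_iff]
      linarith [norm_le_of_mem_cube hR hx]
    · exact ENNReal.mul_lt_top (ENNReal.mul_lt_top ENNReal.one_lt_top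
        (ENNReal.inv_lt_top.2 (Metric.measure_ball_pos volume _ (half_pos hr)))) measure_ball_lt_top
  obtain ⟨Λ, hΛ, rfl⟩ := hη
  have hm : ∀ {s : Set (Space d)}, MeasurableSet s →
      MeasurableSet (Prod.fst ⁻¹' s : Set (ColouredSpace d m)) := fun h => measurable_fst h
  rw [Measure.sum_apply _ (hm (measurableSet_cube R))] at hlt
  simp_rw [Measure.dirac_apply' _ (hm (measurableSet_cube R))] at hlt
  have hfin := ENNReal.finite_const_le_of_tsum_ne_top hlt.ne one_ne_zero
  refine ⟨(hfin.toFinset.image fun p : Λ => (p : ColouredSpace d m).1).filter (· ∈ cube d R),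
    fun x hx => by simpa using (Finset.mem_filter.1 (Finset.mem_coe.1 hx)).2, ?_⟩
  rw [Measure.sum_apply _ (hm ((measurableSet_cube R).diff (Finset.measurableSet _))),
    ENNReal.tsum_eq_zero]
  intro p
  rw [Measure.dirac_apply' _ (hm ((measurableSet_cube R).diff (Finset.measurableSet _)))]
  refine Set.indicator_of_notMem (fun hp => hp.2 ?_) _
  refine Finset.mem_coe.2 (Finset.mem_filter.2 ⟨Finset.mem_image.2 ⟨p, ?_, rfl⟩, hp.1⟩)
  refine hfin.mem_toFinset.2 ?_
  have : (p : ColouredSpace d m) ∈ (Prod.fst ⁻¹' cube d R : Set (ColouredSpace d m)) := hp.1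
  rw [Set.mem_ofPred_eq, Set.indicator_of_mem this]
  exact le_rfl

theorem average_eq_weightedCount {r R : ℝ} (hr : 0 < r) (hR : 0 ≤ R)
    {η : Measure (ColouredSpace d m)} (hη : η ∈ pointMeasures d m r) :
    average w k R η = weightedCount w (averageFun k R) η := by
  classical
  obtain ⟨F, hF, h0⟩ := exists_finset_of_mem_pointMeasures hr hR hη
  have hsp := Sparse.of_mem_pointMeasures hη
  have hc0 : ∀ i, colour η i (cube d R \ F) = 0 := fun i => by
    rw [colour, Measure.map_apply measurable_fst
      ((measurableSet_cube R).diff (Finset.measurableSet _))]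
    exact le_antisymm ((Measure.restrict_apply_le _ _).trans h0.le) zero_le
  have hloc := fun i => (hsp.colour i).isLocallyFiniteMeasure (half_pos hr) ENNReal.one_ne_top
  have hsing : ∀ i, ∀ x ∈ cube d R, x ∉ F → (colour η i).real {x} = 0 := fun i x hx hxF => by
    have hsub : {x} ⊆ cube d R \ (F : Set (Space d)) :=
      Set.singleton_subset_iff.2 ⟨hx, fun h => hxF (Finset.mem_coe.1 h)⟩
    rw [Measure.real, measure_mono_null hsub (hc0 i), ENNReal.toReal_zero]
  have hint : ∀ i, ∫ x, averageFun k R x ∂(colour η i) =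
      (((R ^ d)⁻¹ : ℝ) : ℂ) * ∑ x ∈ F, (colour η i).real {x} * character k x := fun i => by
    rw [averageFun, integral_indicator (measurableSet_cube R), integral_const_mul]
    congr 1
    have hae : (cube d R : Set (Space d)) =ᵐ[colour η i] (F : Set (Space d)) :=
      (ae_eq_set).2 ⟨hc0 i, by rw [Set.sdiff_eq_empty.2 hF]; exact measure_empty⟩
    rw [setIntegral_congr_set hae, setIntegral_finset]
    · simp only [Complex.real_smul]
    · refine IntegrableOn.of_bound F.finite_toSet.isCompact.measure_lt_top
        (continuous_character k).aestronglyMeasurable 1 (Eventually.of_forall fun x => ?_)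
      exact (norm_character k x).le
  rw [weightedCount, average, volume_real_cube hR]
  simp_rw [hint]
  have hmass : ∀ x ∈ cube d R, x ∉ F → weightedMass w η x = 0 := fun x hx hxF =>
    Finset.sum_eq_zero fun i _ => by rw [hsing i x hx hxF, mul_zero]
  rw [tsum_subtype (cube d R) fun x => (weightedMass w η x : ℂ) * character k x,
    tsum_eq_sum (s := F) fun x hxF => ?_]
  · rw [Finset.sum_congr rfl fun x hx => Set.indicator_of_mem (hF hx) _]
    simp only [weightedMass, Complex.ofReal_sum, Complex.ofReal_mul, Finset.sum_mul,
      Finset.mul_sum]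
    rw [Finset.sum_comm]
    refine Finset.sum_congr rfl fun i _ => Finset.sum_congr rfl fun x _ => ?_
    push_cast
    ring
  · by_cases hx : x ∈ cube d R
    · rw [Set.indicator_of_mem hx, hmass x hx hxF, Complex.ofReal_zero, zero_mul]
    · exact Set.indicator_of_notMem hx _

theorem measurable_averageFun (R : ℝ) : Measurable (averageFun k R) :=
  (measurable_const.mul (continuous_character k).measurable).indicator (measurableSet_cube R)

theorem exists_averageFun_le_weight {R : ℝ} (hR : 0 ≤ R) :
    ∃ B, ∀ x, ‖averageFun k R x‖ ≤ B * weight x := by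
  refine ⟨(R ^ d)⁻¹ * (1 + d * R) ^ (d + 1 : ℝ), fun x => ?_⟩
  by_cases hx : x ∈ cube d R
  · rw [averageFun, Set.indicator_of_mem hx, norm_mul, norm_character, mul_one, Complex.norm_real,
      Real.norm_of_nonneg (by positivity), mul_assoc]
    refine le_mul_of_one_le_right (by positivity) ?_
    rw [weight, Real.rpow_neg (by positivity), ← div_eq_mul_inv, one_le_div (by positivity)]
    refine Real.rpow_le_rpow (by positivity) ?_ (by positivity)
    linarith [norm_le_of_mem_cube hR hx]
  · rw [averageFun, Set.indicator_of_notMem hx, norm_zero]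
    have := weight_pos x
    positivity

theorem memLp_average {μ : Measure (Measure (ColouredSpace d m))} [IsProbabilityMeasure μ]
    {r R : ℝ} (hr : 0 < r) (hμ : ∀ᵐ η ∂μ, η ∈ pointMeasures d m r) (hR : 0 ≤ R) :
    MemLp (average w k R) 2 μ := by
  obtain ⟨B, hB⟩ := exists_averageFun_le_weight k hR
  have h : MemLp (weightedCount w (averageFun k R)) 2 μ :=
    (memLp_top_weightedCount w (ρ := r / 2)
      (hμ.mono fun η hη => (Sparse.of_mem_pointMeasures hη).mem_sparseSet) (half_pos hr)
      (measurable_averageFun k R) (b := 0) (by simpa using hB)).mono_exponent le_top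
  refine h.ae_eq ?_
  filter_upwards [hμ] with η hη
  exact (average_eq_weightedCount w k hr hR hη).symm

theorem contDiff_character : ContDiff ℝ ∞ (character k) := by
  unfold character
  have h : ContDiff ℝ ∞ fun x : Space d => ((inner ℝ k x : ℝ) : ℂ) :=
    Complex.ofRealCLM.contDiff.comp (contDiff_const.inner ℝ contDiff_id)
  exact (contDiff_const.mul h).cexp

theorem hasCompactSupport_scaled {φ : Space d → ℝ} (hc : HasCompactSupport φ) {R : ℝ}
    (hR : 0 < R) : HasCompactSupport fun x =>
      (((R ^ d)⁻¹ * φ (R⁻¹ • x) : ℝ) : ℂ) * character k x :=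
  (((hc.comp_smul (c := R⁻¹) (inv_ne_zero hR.ne')).mul_left (f := fun _ => (R ^ d)⁻¹)).comp_left
    (g := fun t : ℝ => (t : ℂ)) Complex.ofReal_zero).mul_right

theorem contDiff_scaled {φ : Space d → ℝ} (hφ : ContDiff ℝ ∞ φ) (R : ℝ) :
    ContDiff ℝ ∞ fun x => (((R ^ d)⁻¹ * φ (R⁻¹ • x) : ℝ) : ℂ) * character k x :=
  (Complex.ofRealCLM.contDiff.comp
    (contDiff_const.mul (hφ.comp (contDiff_const_smul R⁻¹)))).mul (contDiff_character k)

/-- The modulated mean `R^{-d} φ(x/R) χ_k(x)` for a smooth compactly supported `φ`. -/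
noncomputable def scaled {φ : Space d → ℝ} (hφ : ContDiff ℝ ∞ φ) (hc : HasCompactSupport φ)
    {R : ℝ} (hR : 0 < R) : 𝓢(Space d, ℂ) :=
  (hasCompactSupport_scaled k hc hR).toSchwartzMap (contDiff_scaled k hφ R)

/-- Substitute `u = R⁻¹ • x`: the Jacobian `R ^ d` cancels the normalisation, and the character
shifts the frequency by `k`. -/
theorem fourier_scaled {φ : Space d → ℝ} (hφ : ContDiff ℝ ∞ φ) (hc : HasCompactSupport φ)
    {R : ℝ} (hR : 0 < R) (y : Space d) :
    𝓕 (scaled k hφ hc hR) y = 𝓕 (toComplexSchwartz φ hφ hc) (R • (y - k)) := by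
  rw [SchwartzMap.fourier_coe, SchwartzMap.fourier_coe, Real.fourier_eq, Real.fourier_eq]
  have h := Measure.integral_comp_inv_smul (volume : Measure (Space d)) (fun u : Space d =>
    Real.fourierChar (-inner ℝ u (R • (y - k))) • (toComplexSchwartz φ hφ hc u)) R
  have hRd : (0 : ℝ) < R ^ d := by positivity
  rw [finrank_euclideanSpace, Fintype.card_fin, abs_of_pos hRd] at h
  have h2 : ∀ x : Space d, Real.fourierChar (-inner ℝ x y) • (scaled k hφ hc hR x) =
      (R ^ d)⁻¹ • (Real.fourierChar (-inner ℝ (R⁻¹ • x) (R • (y - k))) •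
        toComplexSchwartz φ hφ hc (R⁻¹ • x)) := fun x => by
    change Real.fourierChar (-inner ℝ x y) •
      ((((R ^ d)⁻¹ * φ (R⁻¹ • x) : ℝ) : ℂ) * character k x) = (R ^ d)⁻¹ •
        (Real.fourierChar (-inner ℝ (R⁻¹ • x) (R • (y - k))) • ((φ (R⁻¹ • x) : ℝ) : ℂ))
    have h3 : (Real.fourierChar (-inner ℝ (R⁻¹ • x) (R • (y - k))) : ℂ) =
        Real.fourierChar (-inner ℝ x y) * character k x := by
      rw [real_inner_smul_left, real_inner_smul_right, inv_mul_cancel_left₀ hR.ne',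
        Real.fourierChar_apply, Real.fourierChar_apply, character, ← Complex.exp_add,
        inner_sub_right, real_inner_comm k x]
      congr 1
      push_cast
      ring
    rw [Circle.smul_def, Circle.smul_def, h3, Complex.real_smul, smul_eq_mul, smul_eq_mul]
    push_cast
    ring
  simp_rw [h2]
  rw [integral_smul, h, inv_smul_smul₀ hRd.ne']

end Average

/-! ### Concentration of dilated Schwartz functions at a point. -/

section Limit

variable {d : ℕ} {K : ℝ≥0∞} {ν : Measure (Space d)} (k : Space d)

theorem weight_le_one (x : Space d) : weight x ≤ 1 :=
  Real.rpow_le_one_of_one_le_of_nonpos (by linarith [norm_nonneg x]) (by linarith)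

theorem weight_smul_le {R : ℝ} (hR : 1 ≤ R) (x : Space d) : weight (R • x) ≤ weight x := by
  unfold weight
  refine Real.rpow_le_rpow_of_nonpos (by positivity) ?_ (by linarith)
  rw [norm_smul, Real.norm_of_nonneg (by linarith)]
  nlinarith [norm_nonneg x]

/-- Dilates of a Schwartz function converge in `L²` to a multiple of the indicator function of a
point. -/
theorem TranslationBounded.tendsto_eLpNorm_dilation (hν : TranslationBounded 1 K ν) (hK : K ≠ ⊤)
    (h : 𝓢(Space d, ℂ)) :
    Tendsto (fun R : ℝ => eLpNorm (fun y => h (R • (y - k)) -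
      h 0 * Set.indicator {k} (fun _ => (1 : ℂ)) y) 2 ν) atTop (𝓝 0) := by
  obtain ⟨B, hB⟩ := exists_norm_le_weight h
  have hB0 : 0 ≤ B := nonneg_of_norm_le_weight (b := 0) (by simpa using hB)
  have hlim : Tendsto (fun R : ℝ => ∫⁻ y, ‖h (R • (y - k)) -
      h 0 * Set.indicator {k} (fun _ => (1 : ℂ)) y‖ₑ ^ (2 : ℝ) ∂ν) atTop (𝓝 (∫⁻ _, 0 ∂ν)) := by
    -- For `R ≥ 1` the square is dominated by `B² * weight`, since `weight² ≤ weight` and dilation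
    -- decreases `weight`. Pointwise, the difference is `0` at `k`, and elsewhere `R • (y - k)`
    -- escapes to infinity.
    refine tendsto_lintegral_filter_of_dominated_convergence
      (fun y => ENNReal.ofReal (B ^ 2) * ENNReal.ofReal (weight (y - k))) ?_ ?_ ?_ ?_
    · refine Eventually.of_forall fun R => ?_
      have h1 : Measurable fun y : Space d => h (R • (y - k)) :=
        (h.continuous.comp (by fun_prop)).measurable
      have h2 : Measurable (Set.indicator {k} fun _ : Space d => (1 : ℂ)) :=
        measurable_const.indicator (measurableSet_singleton k)
      exact ((h1.sub (h2.const_mul _)).enorm).pow_const _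
    · filter_upwards [eventually_ge_atTop 1] with R hR
      refine Eventually.of_forall fun y => ?_
      have hbound : ‖h (R • (y - k)) - h 0 * Set.indicator {k} (fun _ => (1 : ℂ)) y‖ ≤
          B * weight (y - k) := by
        by_cases hy : y = k
        · rw [hy]
          simpa using mul_nonneg hB0 (weight_pos (0 : Space d)).le
        · rw [Set.indicator_of_notMem (by simpa using hy), mul_zero, sub_zero]
          exact (hB _).trans (mul_le_mul_of_nonneg_left (weight_smul_le hR _) hB0)
      rw [← ofReal_norm, ENNReal.ofReal_rpow_of_nonneg (norm_nonneg _) zero_le_two,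
        ← ENNReal.ofReal_mul (by positivity)]
      refine ENNReal.ofReal_le_ofReal ?_
      rw [Real.rpow_two]
      calc _ ≤ (B * weight (y - k)) ^ 2 := pow_le_pow_left₀ (norm_nonneg _) hbound 2
        _ = B ^ 2 * (weight (y - k) * weight (y - k)) := by ring
        _ ≤ B ^ 2 * (weight (y - k) * 1) := by
            gcongr
            · exact (weight_pos _).le
            · exact weight_le_one _
        _ = B ^ 2 * weight (y - k) := by ring
    · rw [lintegral_const_mul' _ _ ENNReal.ofReal_ne_top]
      exact ENNReal.mul_ne_top ENNReal.ofReal_ne_top ((hν.lintegral_weight_le one_pos hK k).trans_lt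
        (weightBound_ne_top one_pos hK).lt_top).ne
    · refine Eventually.of_forall fun y => ?_
      by_cases hy : y = k
      · simp [hy]
      · simp only [Set.indicator_of_notMem (show y ∉ ({k} : Set (Space d)) by simpa using hy),
          mul_zero, sub_zero]
        have h0 : 0 < ‖y - k‖ := norm_pos_iff.2 (sub_ne_zero.2 hy)
        have hcob : Tendsto (fun R : ℝ => R • (y - k)) atTop (cocompact (Space d)) := by
          rw [← Metric.cobounded_eq_cocompact, ← tendsto_norm_atTop_iff_cobounded]
          simp_rw [norm_smul]
          exact tendsto_norm_atTop_atTop.atTop_mul_const h0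
        have := ((h.tendsto_cocompact).comp hcob).enorm
        simpa using this.ennrpow_const 2
  rw [lintegral_zero] at hlim
  have := hlim.ennrpow_const (1 / 2)
  simp only [eLpNorm_eq_lintegral_rpow_enorm_toReal two_ne_zero ENNReal.ofNat_ne_top,
    ENNReal.toReal_ofNat]
  simpa using this

end Limit

end ColouredPointProcess

namespace ColouredPointProcess

open ProbabilityTheory
open scoped ContDiff

/-! ### Boundary error of the smoothing. -/

section Shell

variable {d m : ℕ} {ρ ε R : ℝ} (w : Fin m → ℝ) (k : Space d)

theorem cube_mono {a b : ℝ} (h : a ≤ b) : cube d a ⊆ cube d b := fun x hx j =>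
  (hx j).trans_le (by linarith)

theorem inv_smul_mem_cube (hR : 0 < R) (a : ℝ) (x : Space d) :
    R⁻¹ • x ∈ cube d a ↔ x ∈ cube d (a * R) := by
  refine forall_congr' fun j => ?_
  rw [PiLp.smul_apply, smul_eq_mul, abs_mul, abs_of_pos (inv_pos.2 hR), inv_mul_lt_iff₀ hR]
  rw [show a * R / 2 = R * (a / 2) by ring]

theorem abs_sub_apply_le (x a : Space d) (j : Fin d) : |x j - a j| ≤ dist x a := by
  rw [dist_eq_norm]
  exact PiLp.norm_apply_le (x - a) j

/-- A smooth approximation of the indicator function of `C_1`. -/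
theorem exists_smooth_cube (d : ℕ) (hε : 0 < ε) :
    ∃ φ : Space d → ℝ, ContDiff ℝ ∞ φ ∧ HasCompactSupport φ ∧
      (∀ x ∈ cube d (1 - ε), φ x = 1) ∧ (∀ x ∉ cube d 1, φ x = 0) ∧ ∀ x, 0 ≤ φ x ∧ φ x ≤ 1 := by
  have hclosed : IsClosed {x : Space d | ∀ j, |x j| ≤ (1 - ε) / 2} := by
    simp only [Set.ofPred_forall]
    exact isClosed_iInter fun j => isClosed_le (by fun_prop) continuous_const
  have hcomp : IsCompact {x : Space d | ∀ j, |x j| ≤ (1 - ε) / 2} := by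
    refine (isCompact_closedBall (0 : Space d) (d * 1)).of_isClosed_subset hclosed fun x hx => ?_
    rw [mem_closedBall_zero_iff]
    refine norm_le_of_mem_cube zero_le_one fun j => ?_
    have h := (show ∀ j, |x j| ≤ (1 - ε) / 2 from hx) j
    linarith
  obtain ⟨φ, h1, h2, h3, h4, h5⟩ := exists_smooth_cutoff hcomp (isOpen_cube 1)
    fun x hx j => by
      have h := (show ∀ j, |x j| ≤ (1 - ε) / 2 from hx) j
      linarith
  exact ⟨φ, h1, h2, fun x hx => h3.self_of_nhdsSet x fun j => (hx j).le, h4, h5⟩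

variable {φ : Space d → ℝ} (hφ : ContDiff ℝ ∞ φ) (hc : HasCompactSupport φ)

theorem norm_averageFun_sub_scaled_le (h1 : ∀ x ∈ cube d (1 - ε), φ x = 1)
    (h0 : ∀ x ∉ cube d 1, φ x = 0) (hb : ∀ x, 0 ≤ φ x ∧ φ x ≤ 1) (hR : 0 < R) (x : Space d) :
    ‖averageFun k R x - scaled k hφ hc hR x‖ ≤
      (R ^ d)⁻¹ * (cube d R \ cube d ((1 - ε) * R)).indicator 1 x := by
  classical
  have hs : scaled k hφ hc hR x = (((R ^ d)⁻¹ * φ (R⁻¹ • x) : ℝ) : ℂ) * character k x := rfl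
  have hR' : (0 : ℝ) ≤ (R ^ d)⁻¹ := by positivity
  have hi1 := inv_smul_mem_cube hR 1 x
  have hiε := inv_smul_mem_cube hR (1 - ε) x
  rw [one_mul] at hi1
  rw [hs, averageFun]
  by_cases hx : x ∈ cube d R
  · rw [Set.indicator_of_mem hx, ← sub_mul, norm_mul, norm_character, mul_one,
      ← Complex.ofReal_sub, Complex.norm_real, Real.norm_eq_abs, ← mul_one_sub, abs_mul,
      abs_of_nonneg hR']
    refine mul_le_mul_of_nonneg_left ?_ hR'
    by_cases hx' : x ∈ cube d ((1 - ε) * R)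
    · rw [h1 _ (hiε.2 hx'), Set.indicator_of_notMem fun h => h.2 hx']
      simp
    · rw [Set.indicator_of_mem (Set.mem_sdiff _ |>.2 ⟨hx, hx'⟩), Pi.one_apply, abs_of_nonneg (by linarith [(hb (R⁻¹ • x)).2])]
      linarith [(hb (R⁻¹ • x)).1]
  · rw [Set.indicator_of_notMem hx, h0 _ (fun h => hx (hi1.1 h)),
      Set.indicator_of_notMem fun h => hx h.1]
    simp

/-- This is the shell `C_R \ C_{(1-ε)R}`, on which the smoothing may differ, thickened by `ε R / 2`
on either side; `ε < 1 / 2` keeps the inner edge positive. -/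
theorem volume_shell (hε : 0 < ε) (hε' : ε < 1 / 2) (hR : 0 < R) :
    volume (cube d ((1 + ε) * R) \ cube d ((1 - 2 * ε) * R)) =
      ENNReal.ofReal (R ^ d * ((1 + ε) ^ d - (1 - 2 * ε) ^ d)) := by
  have h1 : 0 ≤ (1 + ε) * R := by positivity
  have h2 : 0 ≤ (1 - 2 * ε) * R := mul_nonneg (by linarith) hR.le
  rw [measure_sdiff (cube_mono (mul_le_mul_of_nonneg_right (by linarith) hR.le))
    (measurableSet_cube _).nullMeasurableSet
    (by rw [volume_cube]; exact ENNReal.pow_ne_top ENNReal.ofReal_ne_top), volume_cube,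
    volume_cube, ← ENNReal.ofReal_pow h1, ← ENNReal.ofReal_pow h2,
    ← ENNReal.ofReal_sub _ (by positivity)]
  congr 1
  rw [mul_pow, mul_pow]
  ring

/-- By sparseness the number of points in the shell is at most the volume of the shell thickened by
`r / 2 ≤ ε R / 2`, divided by that of an `r / 2`-ball. After division by `R ^ d` the bound depends
neither on `R` nor on `η`. -/
theorem norm_average_sub_weightedCount_le {r : ℝ} (hr : 0 < r) (hε : 0 < ε) (hε' : ε < 1 / 2)
    (h1 : ∀ x ∈ cube d (1 - ε), φ x = 1) (h0 : ∀ x ∉ cube d 1, φ x = 0)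
    (hb : ∀ x, 0 ≤ φ x ∧ φ x ≤ 1) (hR : 0 < R) (hRr : r ≤ ε * R)
    {η : Measure (ColouredSpace d m)} (hη : η ∈ pointMeasures d m r) :
    ‖average w k R η - weightedCount w (scaled k hφ hc hR) η‖ ≤
      (∑ i, |w i|) * (((volume (Metric.ball (0 : Space d) (r / 2)))⁻¹).toReal *
        ((1 + ε) ^ d - (1 - 2 * ε) ^ d)) := by
  classical
  have hsp := Sparse.of_mem_pointMeasures hη
  have hr2 := half_pos hr
  obtain ⟨B, hB⟩ := exists_averageFun_le_weight k hR.le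
  obtain ⟨B', hB'⟩ := exists_norm_le_weight (scaled k hφ hc hR)
  have hRd : (0 : ℝ) < R ^ d := by positivity
  have hmono : (1 - 2 * ε) ^ d ≤ (1 + ε) ^ d := pow_le_pow_left₀ (by linarith) (by linarith) d
  rw [average_eq_weightedCount w k hr hR.le hη, weightedCount, weightedCount,
    ← Finset.sum_sub_distrib, Finset.sum_mul]
  refine norm_sum_le_of_le _ fun i _ => ?_
  rw [← mul_sub, norm_mul, Complex.norm_real, Real.norm_eq_abs]
  refine mul_le_mul_of_nonneg_left ?_ (abs_nonneg _)
  rw [← integral_sub (integrable_colour hsp hr2 (measurable_averageFun k R) (b := 0)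
    (by simpa using hB) i) (integrable_colour hsp hr2 (scaled k hφ hc hR).continuous.measurable
    (b := 0) (by simpa using hB') i)]
  set S := cube d R \ cube d ((1 - ε) * R) with hS
  set T := cube d ((1 + ε) * R) \ cube d ((1 - 2 * ε) * R) with hT
  have hSm : MeasurableSet S := (measurableSet_cube _).diff (measurableSet_cube _)
  have hTm : MeasurableSet T := (measurableSet_cube _).diff (measurableSet_cube _)
  have hST : colour η i S ≤ (volume (Metric.ball (0 : Space d) (r / 2)))⁻¹ *
      ENNReal.ofReal (R ^ d * ((1 + ε) ^ d - (1 - 2 * ε) ^ d)) := by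
    have h := (hsp.colour i).lintegral_le hr2 ENNReal.one_ne_top
      (f := S.indicator 1) (g := T.indicator 1) (measurable_one.indicator hSm) fun x a hxa => by
        by_cases hx : x ∈ S
        · have ha : a ∈ T := by
            refine ⟨fun j => ?_, fun ha => hx.2 fun j => ?_⟩
            · have h2 := abs_sub_apply_le x a j
              have h3 := hx.1 j
              rw [abs_le] at h2
              rw [abs_lt] at h3 ⊢
              constructor <;> linarith
            · have h2 := abs_sub_apply_le x a j
              have h3 := ha j
              rw [abs_le] at h2
              rw [abs_lt] at h3 ⊢
              constructor <;> linarith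
          rw [Set.indicator_of_mem hx, Set.indicator_of_mem ha]
          exact le_rfl
        · rw [Set.indicator_of_notMem hx]
          exact zero_le
    rwa [lintegral_indicator_one hSm, lintegral_indicator_one hTm, one_mul, hT,
      volume_shell hε hε' hR] at h
  have hVtop : (volume (Metric.ball (0 : Space d) (r / 2)))⁻¹ ≠ ⊤ :=
    ENNReal.inv_ne_top.2 (Metric.measure_ball_pos volume _ hr2).ne'
  have hreal : (colour η i).real S ≤ ((volume (Metric.ball (0 : Space d) (r / 2)))⁻¹).toReal *
      (R ^ d * ((1 + ε) ^ d - (1 - 2 * ε) ^ d)) := by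
    refine (ENNReal.toReal_mono (ENNReal.mul_ne_top hVtop ENNReal.ofReal_ne_top) hST).trans_eq ?_
    rw [ENNReal.toReal_mul, ENNReal.toReal_ofReal (mul_nonneg hRd.le (sub_nonneg.2 hmono))]
  have hStop : colour η i S ≠ ⊤ :=
    (hST.trans_lt (ENNReal.mul_lt_top hVtop.lt_top ENNReal.ofReal_lt_top)).ne
  have hint : Integrable (fun x => (R ^ d)⁻¹ * S.indicator 1 x) (colour η i) :=
    ((integrable_indicator_iff hSm).2 (integrableOn_const hStop (C := (1 : ℝ)))).const_mul _
  refine (norm_integral_le_of_norm_le hint (Eventually.of_forall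
    (norm_averageFun_sub_scaled_le k hφ hc h1 h0 hb hR))).trans ?_
  rw [integral_const_mul, integral_indicator_one hSm, inv_mul_le_iff₀ hRd]
  linarith

/-- The value at `0` is `∫ φ`, which lies between the volumes of `C_{1-ε}` and `C_1`. -/
theorem norm_fourier_zero_sub_one_le (hε : 0 < ε) (hε' : ε < 1 / 2)
    (h1 : ∀ x ∈ cube d (1 - ε), φ x = 1) (h0 : ∀ x ∉ cube d 1, φ x = 0)
    (hb : ∀ x, 0 ≤ φ x ∧ φ x ≤ 1) :
    ‖𝓕 (toComplexSchwartz φ hφ hc) 0 - 1‖ ≤ 1 - (1 - ε) ^ d := by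
  classical
  have hF : 𝓕 (toComplexSchwartz φ hφ hc) 0 = ((∫ x, φ x : ℝ) : ℂ) := by
    rw [SchwartzMap.fourier_coe, Real.fourier_eq, ← integral_complex_ofReal]
    simp
  have hφi : Integrable φ := hφ.continuous.integrable_of_hasCompactSupport hc
  have hi : ∀ a : ℝ, Integrable ((cube d a).indicator (1 : Space d → ℝ)) := fun a =>
    (integrable_indicator_iff (measurableSet_cube a)).2 (integrableOn_const
      (by rw [volume_cube]; exact ENNReal.pow_ne_top ENNReal.ofReal_ne_top) (C := (1 : ℝ)))
  have hle : ∫ x, φ x ≤ 1 := by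
    refine (integral_mono hφi (hi 1) fun x => ?_).trans_eq
      (by rw [integral_indicator_one (measurableSet_cube 1), volume_real_cube zero_le_one, one_pow])
    by_cases hx : x ∈ cube d 1
    · simpa [hx] using (hb x).2
    · simp [hx, h0 x hx]
  have hge : (1 - ε) ^ d ≤ ∫ x, φ x := by
    rw [← volume_real_cube (by linarith : 0 ≤ 1 - ε), ← integral_indicator_one (measurableSet_cube _)]
    refine integral_mono (hi _) hφi fun x => ?_
    by_cases hx : x ∈ cube d (1 - ε)
    · simp [hx, h1 x hx]
    · simpa [hx] using (hb x).1
  rw [hF, ← Complex.ofReal_one, ← Complex.ofReal_sub, Complex.norm_real, Real.norm_eq_abs,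
    abs_sub_comm, abs_of_nonneg (by linarith)]
  linarith

end Shell

/-! ### Mean-square convergence of the averages. -/

section Limit

variable {d m : ℕ} {r : ℝ} {μ : Measure (Measure (ColouredSpace d m))} (w : Fin m → ℝ)
  {ν : Measure (Space d)}

/-- The averages converge in `L²(μ)`. -/
theorem tendsto_average [IsProbabilityMeasure μ] (hr : 0 < r)
    (hμ : ∀ᵐ η ∂μ, η ∈ pointMeasures d m r)
    (hν : IsFourierTransform (weightedFirstMoment μ w) ν) {θ : Lp ℂ 2 ν →ₗᵢ[ℂ] Lp ℂ 2 μ}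
    (hθ : IsDiffractionEmbedding μ w ν θ) (k : Space d) :
    Tendsto (fun R : ℝ => eLpNorm (fun η => average w k R η -
      θ ((memLp_indicator_singleton hν k).toLp _) η) 2 μ) atTop (𝓝 0) := by
  have hs : ∀ᵐ η ∂μ, Sparse (r / 2) η := hμ.mono fun η hη => Sparse.of_mem_pointMeasures hη
  have hr2 := half_pos hr
  obtain ⟨K, hK, hb⟩ := hν.translationBounded w hr2 hs
  have := hb.hasTemperateGrowth one_pos hK
  rw [isDiffractionEmbedding_iff w hr2 hs] at hθ
  set u := Set.indicator {k} fun _ : Space d => (1 : ℂ) with hu_def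
  have hu : MemLp u 2 ν := memLp_indicator_singleton hν k
  set V := ((volume (Metric.ball (0 : Space d) (r / 2)))⁻¹).toReal with hV
  have herr : Tendsto (fun ε : ℝ =>
      ENNReal.ofReal ((∑ i, |w i|) * (V * ((1 + ε) ^ d - (1 - 2 * ε) ^ d))) +
        ENNReal.ofReal (1 - (1 - ε) ^ d) * eLpNorm u 2 ν) (𝓝[>] 0) (𝓝 0) := by
    have hc : ContinuousAt (fun ε : ℝ =>
      ENNReal.ofReal ((∑ i, |w i|) * (V * ((1 + ε) ^ d - (1 - 2 * ε) ^ d)))) 0 :=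
        (ENNReal.continuous_ofReal.comp (by fun_prop)).continuousAt
    have hc' : ContinuousAt (fun ε : ℝ => ENNReal.ofReal (1 - (1 - ε) ^ d)) 0 :=
      (ENNReal.continuous_ofReal.comp (by fun_prop)).continuousAt
    have h := hc.tendsto.add (ENNReal.Tendsto.mul_const hc'.tendsto (Or.inr hu.2.ne))
    simp only [add_zero, mul_zero, sub_zero, one_pow, sub_self, ENNReal.ofReal_zero, zero_mul] at h
    exact h.mono_left nhdsWithin_le_nhds
  rw [ENNReal.tendsto_nhds_zero]
  intro e he
  have he2 : 0 < e / 2 := ENNReal.half_pos he.ne'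
  -- First `ε` is fixed so that the shell error and the defect `|φ̂(0) - 1|` together cost at most
  -- `e / 2`; then `R` is taken so large that the dilation error is at most `e / 2`.
  obtain ⟨ε, hεe, hε, hε'⟩ := ((ENNReal.tendsto_nhds_zero.1 herr _ he2).and
    (Ioo_mem_nhdsGT (show (0 : ℝ) < 1 / 2 by norm_num))).exists
  obtain ⟨φ, hφ, hc, h1, h0, hφb⟩ := exists_smooth_cube d hε
  filter_upwards [eventually_gt_atTop 0, eventually_ge_atTop (r / ε),
    ENNReal.tendsto_nhds_zero.1
      (hb.tendsto_eLpNorm_dilation k hK (𝓕 (toComplexSchwartz φ hφ hc))) _ he2] with R hR hRr hRe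
  rw [div_le_iff₀ hε, mul_comm] at hRr
  set f := scaled k hφ hc hR with hf
  set c := 𝓕 (toComplexSchwartz φ hφ hc) 0 with hc_def
  have hN := memLp_weightedCount w hr2 hs f
  have hmain : eLpNorm (fun η => weightedCount w f η - θ (hu.toLp u) η) 2 μ ≤
      e / 2 + ENNReal.ofReal (1 - (1 - ε) ^ d) * eLpNorm u 2 ν := by
    have hFm : MemLp (𝓕 f : 𝓢(Space d, ℂ)) 2 ν := (𝓕 f).memLp 2 ν
    -- As `θ` is isometric, the distance can be computed in `L²(ν)`, where the Fourier transform is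
    -- explicit.
    have e1 : eLpNorm (fun η => weightedCount w f η - θ (hu.toLp u) η) 2 μ =
        eLpNorm (fun y => 𝓕 f y - u y) 2 ν := by
      calc _ = ‖countₗ w hr2 hs f - θ (hu.toLp u)‖ₑ := by
            rw [Lp.enorm_def]
            refine eLpNorm_congr_ae ?_
            filter_upwards [Lp.coeFn_sub (countₗ w hr2 hs f) (θ (hu.toLp u)), hN.coeFn_toLp]
              with η h2 h3
            rw [h2, Pi.sub_apply]
            congr 1
            exact h3.symm
        _ = ‖hFm.toLp _ - hu.toLp u‖ₑ := by
            rw [← hθ f, ← map_sub, ← ofReal_norm, LinearIsometry.norm_map, ofReal_norm]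
            rfl
        _ = _ := by
            rw [← MemLp.toLp_sub, Lp.enorm_toLp]
            rfl
    rw [e1]
    have e2 : (fun y => 𝓕 f y - u y) =
        (fun y => 𝓕 (toComplexSchwartz φ hφ hc) (R • (y - k)) - c * u y) + (c - 1) • u := by
      ext y
      simp only [Pi.add_apply, Pi.smul_apply, smul_eq_mul, hf, fourier_scaled]
      ring
    rw [e2]
    refine (eLpNorm_add_le ?_ (hu.1.const_smul _) one_le_two).trans (add_le_add hRe ?_)
    · exact (((𝓕 (toComplexSchwartz φ hφ hc)).continuous.comp
        (by fun_prop)).aestronglyMeasurable).sub (hu.1.const_mul c)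
    · rw [eLpNorm_const_smul]
      gcongr
      rw [← ofReal_norm]
      exact ENNReal.ofReal_le_ofReal
        (norm_fourier_zero_sub_one_le hφ hc hε hε' h1 h0 hφb)
  have hshell : eLpNorm (fun η => average w k R η - weightedCount w f η) 2 μ ≤
      ENNReal.ofReal ((∑ i, |w i|) * (V * ((1 + ε) ^ d - (1 - 2 * ε) ^ d))) := by
    refine (eLpNorm_le_of_ae_bound (hμ.mono fun η hη =>
      norm_average_sub_weightedCount_le w k hφ hc hr hε hε' h1 h0 hφb hR hRr hη)).trans_eq ?_
    rw [measure_univ, ENNReal.one_rpow, one_mul]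
  calc _ = eLpNorm ((fun η => average w k R η - weightedCount w f η) +
        fun η => weightedCount w f η - θ (hu.toLp u) η) 2 μ := by
        congr 1
        ext η
        exact (sub_add_sub_cancel _ _ _).symm
    _ ≤ _ := eLpNorm_add_le ((memLp_average w k hr hμ hR.le).1.sub hN.1)
        (hN.1.sub (Lp.aestronglyMeasurable _)) one_le_two
    _ ≤ ENNReal.ofReal ((∑ i, |w i|) * (V * ((1 + ε) ^ d - (1 - 2 * ε) ^ d))) +
        (e / 2 + ENNReal.ofReal (1 - (1 - ε) ^ d) * eLpNorm u 2 ν) := add_le_add hshell hmain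
    _ ≤ e / 2 + e / 2 := by
        rw [add_left_comm]
        gcongr
    _ = e := ENNReal.add_halves e

end Limit

/-! ### Reflection symmetry, eigenvalues and atoms. -/

section Eigenvalue

variable {d m : ℕ} {μ : Measure (Measure (ColouredSpace d m))} (w : Fin m → ℝ)
  {T : (Space d → ℂ) → ℂ} {ν : Measure (Space d)}

theorem fourier_neg_eq_conj (f g h : 𝓢(Space d, ℂ)) (hg : ∀ x, g x = f (-x))
    (hh : ∀ x, h x = starRingEnd ℂ (f x)) (y : Space d) :
    𝓕 g y = starRingEnd ℂ (𝓕 h y) := by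
  rw [SchwartzMap.fourier_coe, SchwartzMap.fourier_coe, Real.fourier_eq, Real.fourier_eq,
    ← integral_conj, ← integral_neg_eq_self]
  refine integral_congr_ae (Eventually.of_forall fun x => ?_)
  simp only [hg, hh, Circle.smul_def, smul_eq_mul, map_mul, Complex.conj_conj, neg_neg,
    inner_neg_left]
  rw [← Circle.coe_inv_eq_conj, ← AddChar.map_neg_eq_inv, neg_neg]

/-- The weights are real, so the moment commutes with conjugation; on the Fourier side, reflecting
`f` amounts to conjugating both `f` and its transform. With uniqueness this makes `ν` symmetric. -/
theorem IsFourierTransform.map_neg (hν : IsFourierTransform (weightedFirstMoment μ w) ν) :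
    IsFourierTransform (weightedFirstMoment μ w) (ν.map Neg.neg) := by
  have hemb : MeasurableEmbedding (Neg.neg : Space d → Space d) :=
    (Homeomorph.neg (Space d)).measurableEmbedding
  have hloc := hν.isLocallyFinite
  let reflect : 𝓢(Space d, ℂ) → 𝓢(Space d, ℂ) :=
    SchwartzMap.compCLMOfContinuousLinearEquiv ℝ (ContinuousLinearEquiv.neg ℝ)
  have hreflect : ∀ f x, reflect f x = f (-x) := fun f x => rfl
  refine ⟨⟨fun x => ?_⟩, fun f => ?_, fun f => ?_⟩
  · obtain ⟨s, hs, hfin⟩ := hloc.finiteAtNhds (-x)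
    refine ⟨Neg.neg ⁻¹' s, continuous_neg.continuousAt.preimage_mem_nhds hs, ?_⟩
    rw [hemb.map_apply]
    simpa [← Set.preimage_comp] using hfin
  · rw [hemb.integrable_map_iff]
    exact hν.integrable (reflect f)
  · rw [hemb.integral_map]
    set h : 𝓢(Space d, ℂ) :=
      SchwartzMap.postcompCLM (𝕜 := ℝ) Complex.conjCLE.toContinuousLinearMap f
    have hh : ∀ x, h x = starRingEnd ℂ (f x) := fun x => rfl
    have h1 := hν.integral_eq (reflect f)
    rw [funext (fourier_neg_eq_conj f (reflect f) h (hreflect f) hh), weightedFirstMoment_conj,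
      ← hν.integral_eq h, ← integral_conj] at h1
    simp only [hreflect, hh, Complex.conj_conj] at h1
    rw [h1, hν.integral_eq f]

theorem IsFourierTransform.measure_singleton_neg
    (hν : IsFourierTransform (weightedFirstMoment μ w) ν) (k : Space d) : ν {-k} = ν {k} := by
  have h : ν.map Neg.neg {k} = ν {k} := by rw [hν.unique (hν.map_neg w)]
  rw [Measure.map_apply measurable_neg (measurableSet_singleton k)] at h
  rw [← h]
  congr 1
  ext x
  simp

theorem eq_neg_of_character_eq {k x : Space d} (h : ∀ t, character (-t) x = character k t) :
    x = -k := by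
  by_contra hx
  have hne : x + k ≠ 0 := fun h0 => hx (eq_neg_of_add_eq_zero_left h0)
  have hn : ‖x + k‖ ^ 2 ≠ 0 := pow_ne_zero 2 (norm_ne_zero_iff.2 hne)
  -- Chosen so that `inner t (x + k) = 1 / 2`, where the two characters differ by the factor `-1`.
  set t := (2 * ‖x + k‖ ^ 2)⁻¹ • (x + k) with ht
  have hin : inner ℝ k t = 1 / 2 + inner ℝ (-t) x := by
    have : inner ℝ t (x + k) = (1 / 2 : ℝ) := by
      rw [ht, real_inner_smul_left, real_inner_self_eq_norm_sq]
      field_simp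
    rw [inner_add_right] at this
    rw [inner_neg_left, real_inner_comm]
    linarith
  have h1 := h t
  have h2 : character k t = -character (-t) x := by
    rw [character, character, hin, ← neg_one_mul, ← Complex.exp_pi_mul_I, ← Complex.exp_add]
    congr 1
    push_cast
    ring
  rw [h2, self_eq_neg, ← norm_eq_zero, norm_character] at h1
  exact one_ne_zero h1

theorem U_coeFn (t : Space d) (f : Lp ℂ 2 ν) : U ν t f =ᵐ[ν] fun x => character (-t) x * f x :=
  (memLp_character_mul (-t) (Lp.memLp f)).coeFn_toLp

theorem toLp_indicator_singleton_eq_zero_iff (hν : IsFourierTransform T ν) (k : Space d) :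
    (memLp_indicator_singleton hν k).toLp _ = 0 ↔ ν {k} = 0 := by
  rw [Lp.eq_zero_iff_ae_eq_zero, (memLp_indicator_singleton hν k).coeFn_toLp.congr_left]
  refine ⟨fun h => ?_, fun h => ?_⟩
  · refine measure_mono_null (fun x hx => ?_) (ae_iff.1 h)
    rw [Set.mem_singleton_iff.1 hx]
    simp
  · rw [EventuallyEq, ae_iff]
    refine measure_mono_null (fun x hx => ?_) h
    by_contra hxk
    exact hx (Set.indicator_of_notMem hxk _)

/-- The equation forces `f` to vanish where `χ_{-t}(x) ≠ χ_k(t)` for some `t`, that is, off `-k`.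
Conversely, the indicator of `-k` is an eigenfunction if it is not null. -/
theorem isEigenvalue_iff (hν : IsFourierTransform T ν) (k : Space d) :
    IsEigenvalue ν k ↔ ν {-k} ≠ 0 := by
  refine ⟨fun ⟨f, hf, h⟩ h0 => hf ?_, fun h => ?_⟩
  -- The exceptional null set depends on `t`. Countably many `t` share one, and continuity in `t`
  -- covers the others.
  · have hdense : ∀ᵐ x ∂ν, ∀ n : ℕ, character (-TopologicalSpace.denseSeq (Space d) n) x * f x =
        character k (TopologicalSpace.denseSeq (Space d) n) * f x := by
      rw [ae_all_iff]
      intro n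
      have h1 := U_coeFn (TopologicalSpace.denseSeq (Space d) n) f
      rw [h] at h1
      filter_upwards [h1, Lp.coeFn_smul (character k (TopologicalSpace.denseSeq (Space d) n)) f]
        with x hx hx'
      rw [← hx, hx', Pi.smul_apply, smul_eq_mul]
    rw [Lp.eq_zero_iff_ae_eq_zero]
    filter_upwards [hdense, measure_eq_zero_iff_ae_notMem.1 h0] with x hx hxk
    by_contra hfx
    refine hxk (Set.mem_singleton_iff.2 (eq_neg_of_character_eq fun t => ?_))
    refine congrFun (Continuous.ext_on (TopologicalSpace.denseRange_denseSeq (Space d))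
      (f := fun t => character (-t) x) (g := fun t => character k t) ?_ (continuous_character k)
      ?_) t
    · unfold character
      fun_prop
    · rintro _ ⟨n, rfl⟩
      exact mul_right_cancel₀ hfx (hx n)
  · refine ⟨(memLp_indicator_singleton hν (-k)).toLp _,
      fun h' => h ((toLp_indicator_singleton_eq_zero_iff hν (-k)).1 h'), fun t => Lp.ext ?_⟩
    filter_upwards [U_coeFn t ((memLp_indicator_singleton hν (-k)).toLp _),
      Lp.coeFn_smul (character k t) ((memLp_indicator_singleton hν (-k)).toLp _),
      (memLp_indicator_singleton hν (-k)).coeFn_toLp] with x h1 h2 h3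
    rw [h1, h2, Pi.smul_apply, h3, smul_eq_mul]
    by_cases hx : x = -k
    · rw [hx]
      congr 1
      rw [character, character, inner_neg_neg, real_inner_comm]
    · rw [Set.indicator_of_notMem (by simpa using hx), mul_zero, mul_zero]

theorem tendsto_eLpNorm_zero_iff {r : ℝ} [IsProbabilityMeasure μ] (hr : 0 < r)
    (hμ : ∀ᵐ η ∂μ, η ∈ pointMeasures d m r)
    (hν : IsFourierTransform (weightedFirstMoment μ w) ν) {θ : Lp ℂ 2 ν →ₗᵢ[ℂ] Lp ℂ 2 μ}
    (hθ : IsDiffractionEmbedding μ w ν θ) (k : Space d) :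
    Tendsto (fun R : ℝ => eLpNorm (average w k R) 2 μ) atTop (𝓝 0) ↔ ν {k} = 0 := by
  have hlim := tendsto_average w hr hμ hν hθ k
  rw [← toLp_indicator_singleton_eq_zero_iff hν k,
    ← map_eq_zero_iff θ θ.injective]
  set L := θ ((memLp_indicator_singleton hν k).toLp _) with hL
  refine ⟨fun h => ?_, fun h => ?_⟩
  · have hsum := h.add hlim
    rw [add_zero] at hsum
    rw [← enorm_eq_zero, ← nonpos_iff_eq_zero]
    refine ge_of_tendsto hsum ?_
    filter_upwards [eventually_ge_atTop 0] with R hR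
    have hA := memLp_average w k hr hμ hR
    rw [Lp.enorm_def]
    calc eLpNorm L 2 μ = eLpNorm (average w k R - fun η => average w k R η - L η) 2 μ := by
          congr 1
          ext η
          simp
      _ ≤ _ := eLpNorm_sub_le hA.1 (hA.1.sub (Lp.aestronglyMeasurable L)) one_le_two
  · refine hlim.congr fun R => eLpNorm_congr_ae ?_
    filter_upwards [Lp.eq_zero_iff_ae_eq_zero.1 h] with η hη
    rw [hη, Pi.zero_apply, sub_zero]

end Eigenvalue

end ColouredPointProcess

theorem theorem9p1 {d m : ℕ}
    (μ : Measure (Measure (ColouredPointProcess.ColouredSpace d m)))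
    (hμ : ColouredPointProcess.IsUniformlyDiscreteStationaryErgodic μ)
    (w : Fin m → ℝ) :
    -- the Fourier transform `ν` of the weighted first moment exists, is a positive measure, and
    -- is unique
    ∃ (ν : Measure (ColouredPointProcess.Space d))
      (hν : ColouredPointProcess.IsFourierTransform
        (ColouredPointProcess.weightedFirstMoment μ w) ν),
      (∀ ν' : Measure (ColouredPointProcess.Space d),
        ColouredPointProcess.IsFourierTransform
          (ColouredPointProcess.weightedFirstMoment μ w) ν' → ν' = ν) ∧
    -- the isometric embedding `θ` exists and is unique
    ∃ θ : Lp ℂ 2 ν →ₗᵢ[ℂ] Lp ℂ 2 μ,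
      ColouredPointProcess.IsDiffractionEmbedding μ w ν θ ∧
      (∀ θ' : Lp ℂ 2 ν →ₗᵢ[ℂ] Lp ℂ 2 μ,
        ColouredPointProcess.IsDiffractionEmbedding μ w ν θ' → θ' = θ) ∧
    ∀ k : ColouredPointProcess.Space d,
      -- the averages are elements of `L²(μ)`
      (∀ R : ℝ, 0 < R → MemLp (ColouredPointProcess.average w k R) 2 μ) ∧
      -- the three equivalent conditions
      List.TFAE
        [¬ Tendsto (fun R : ℝ => eLpNorm (ColouredPointProcess.average w k R) 2 μ) atTop (𝓝 0),
          ν {k} ≠ 0,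
          ColouredPointProcess.IsEigenvalue ν k] ∧
      -- the limit of the averages
      (ColouredPointProcess.IsEigenvalue ν k →
        Tendsto (fun R : ℝ => eLpNorm
            (fun η => ColouredPointProcess.average w k R η -
              θ ((ColouredPointProcess.memLp_indicator_singleton hν k).toLp _) η) 2 μ)
          atTop (𝓝 0)) := by

  obtain ⟨r, hr, hμr⟩ := hμ.uniformlyDiscrete
  have := hμ.isProbabilityMeasure
  have hs : ∀ᵐ η ∂μ, ColouredPointProcess.Sparse (r / 2) η :=
    hμr.mono fun η hη => ColouredPointProcess.Sparse.of_mem_pointMeasures hη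
  obtain ⟨ν, hν⟩ :=
    ColouredPointProcess.exists_isFourierTransform w (half_pos hr) hs hμ.stationary
  obtain ⟨θ, hθ, hθu⟩ := hν.existsUnique_embedding w (half_pos hr) hs hμ.stationary
  refine ⟨ν, hν, fun ν' hν' => hν.unique hν', θ, hθ, hθu, fun k =>
    ⟨fun R hR => ColouredPointProcess.memLp_average w k hr hμr hR.le, ?_,
      fun _ => ColouredPointProcess.tendsto_average w hr hμr hν hθ k⟩⟩
  tfae_have 1 ↔ 2 := not_congr (ColouredPointProcess.tendsto_eLpNorm_zero_iff w hr hμr hν hθ k)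
  -- The eigenvalue `k` detects the atom at `-k`; reflection symmetry of `ν` moves it to `k`.
  tfae_have 3 ↔ 2 := by
    rw [ColouredPointProcess.isEigenvalue_iff hν, hν.measure_singleton_neg w]
  tfae_finish
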